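/- Let $\mathbb R\langle x\rangle$ be the free algebra of real polynomials in $g$ non-commuting variables $x=(x_1,\dots,x_g)$, with the involution that fixes every scalar and every $x_j$ and reverses words. Let $p=\sum_w p_w w$ be a symmetric $\delta\times\delta$ matrix with entries in $\mathbb R\langle x\rangle$ (that is, $p=p^*:=\sum_w p_w^{T}w^*$), of degree $d$. For a $g$-tuple $X=(X_1,\dots,X_g)$ of symmetric real $n\times n$ matrices, put $p(X)=\sum_w p_w\otimes w(X)$. Write $p(0)$ for the constant term of $p$ and assume $p(0)\succ 0$. For each $n\ge 1$ let $\mathcal D_p(n)$ be the connected component of $0$ in the set of all $g$-tuples $X$ of symmetric real $n\times n$ matrices with $p(X)\succ 0$. Assume that (a) there is a constant $K$ such that $\sum_{j=1}^g\|X_j\|\le K$ (operator norm) for all $n\ge1$ and all $X\in\mathcal D_p(n)$; and (b) $\mathcal D_p(n)$ is convex for every $n\ge1$. For symmetric real $\mu\times\mu$ matrices $A_1,\dots,A_g$, let $L=I_\mu+\sum_{j=1}^g A_jx_j$ (a monic linear pencil of size $\mu$), $L(X)=I_\mu\otimes I_n+\sum_{j=1}^g A_j\otimes X_j$, and let $\mathcal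 D_L(n)$ be the set of all $g$-tuples $X$ of symmetric real $n\times n$ matrices with $L(X)\succ0$. 1. Let $\nu=\delta\sum_{j=0}^{d}g^j$. There are a $\mu\le\frac{\nu(\nu+1)}2$ and a monic linear pencil $L$ of size $\mu$ such that $\mathcal D_p(n)=\mathcal D_L(n)$ for every $n\ge1$. 2. If $p(0)=I_\delta$, let $\breve\nu=\delta\sum_{j=0}^{\lceil d/2\rceil}g^j$. Then there are a $\mu\le\frac{\breve\nu(\breve\nu+1)}2$ and a monic linear pencil $L$ of size $\mu$ such that $\mathcal D_p(n)=\mathcal D_L(n)$ for every $n\ge1$. -/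

import Mathlib

open scoped Kronecker

noncomputable section

namespace FreeConvex

/-- `ℝ⟨x⟩`: real polynomials in the non-commuting symmetric variables `x₁, …, x_g`. Its `star`
is Mathlib's: it fixes the scalars and every variable and reverses words. -/
abbrev NCPoly (g : ℕ) : Type := FreeAlgebra ℝ (Fin g)

/-- `δ × δ` matrices of nc polynomials. The involution `(∑ p_w w)* = ∑ p_wᵀ w*` is the
conjugate transpose of a matrix over the star ring `NCPoly g`, so that `p* = p` is
`Matrix.IsHermitian p`. -/
abbrev MatPoly (g δ : ℕ) : Type := Matrix (Fin δ) (Fin δ) (NCPoly g)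

/-- Degree of an nc polynomial: the largest length of a word occurring in it. -/
def degree {g : ℕ} (f : NCPoly g) : ℕ :=
  ((FreeAlgebra.basisFreeMonoid ℝ (Fin g)).repr f).support.sup FreeMonoid.length

/-- Degree of a matrix polynomial: the largest degree of an entry. -/
def MatPoly.degree {g δ : ℕ} (p : MatPoly g δ) : ℕ :=
  Finset.univ.sup fun i => Finset.univ.sup fun j => FreeConvex.degree (p i j)

/-- The constant term `p(0)`. -/
def MatPoly.atZero {g δ : ℕ} (p : MatPoly g δ) : Matrix (Fin δ) (Fin δ) ℝ :=
  p.map (FreeAlgebra.lift ℝ (fun _ : Fin g => (0 : ℝ)))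

/-- `g`-tuples of `n × n` real matrices. -/
abbrev Tuple (g n : ℕ) : Type := Fin g → Matrix (Fin n) (Fin n) ℝ

/-- `(𝕊ℝ^{n×n})^g`: the `g`-tuples of symmetric matrices. -/
def symTuples (g n : ℕ) : Set (Tuple g n) := {X | ∀ j, (X j).IsSymm}

/-- The evaluation `p(X)`: the `δ × δ` block matrix whose `(i, j)` block is the `n × n` matrix
`p i j` evaluated at `X` (empty word going to the identity). -/
def MatPoly.eval {g δ n : ℕ} (p : MatPoly g δ) (X : Tuple g n) :
    Matrix (Fin δ × Fin n) (Fin δ × Fin n) ℝ :=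
  Matrix.comp _ _ _ _ ℝ (p.map (FreeAlgebra.lift ℝ X))

/-- `{X ∈ (𝕊ℝ^{n×n})^g : p(X) ≻ 0}`. -/
def MatPoly.posDefSet {g δ : ℕ} (p : MatPoly g δ) (n : ℕ) : Set (Tuple g n) :=
  {X | X ∈ symTuples g n ∧ (p.eval X).PosDef}

/-- `𝒟_p(n)`: the connected component of `0` in `{X ∈ (𝕊ℝ^{n×n})^g : p(X) ≻ 0}`. -/
def MatPoly.positivitySet {g δ : ℕ} (p : MatPoly g δ) (n : ℕ) : Set (Tuple g n) :=
  connectedComponentIn (p.posDefSet n) 0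

/-- Operator norm of a real matrix with respect to the Euclidean norm. -/
def opNorm {n : ℕ} (A : Matrix (Fin n) (Fin n) ℝ) : ℝ :=
  ‖Matrix.toEuclideanCLM (n := Fin n) (𝕜 := ℝ) A‖

/-- A graded set is bounded if one constant bounds `∑ ‖X_j‖` on all its levels. -/
def GradedBounded {g : ℕ} (C : (n : ℕ) → Set (Tuple g n)) : Prop :=
  ∃ K : ℝ, ∀ n : ℕ, 0 < n → ∀ X ∈ C n, ∑ j, opNorm (X j) ≤ K

/-- A graded set is convex if each of its levels is convex. -/
def GradedConvex {g : ℕ} (C : (n : ℕ) → Set (Tuple g n)) : Prop :=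
  ∀ n : ℕ, 0 < n → Convex ℝ (C n)

/-- A monic linear pencil `L = I + A₁ x₁ + ⋯ + A_g x_g` with symmetric `μ × μ` coefficients. -/
structure MonicPencil (g μ : ℕ) where
  /-- The coefficients `A₁, …, A_g`. -/
  coeff : Fin g → Matrix (Fin μ) (Fin μ) ℝ
  /-- The coefficients are symmetric. -/
  isSymm : ∀ j, (coeff j).IsSymm

/-- `L(X) = I_μ ⊗ I_n + ∑ A_j ⊗ X_j`. -/
def MonicPencil.eval {g μ n : ℕ} (L : MonicPencil g μ) (X : Tuple g n) :
    Matrix (Fin μ × Fin n) (Fin μ × Fin n) ℝ :=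
  (1 : Matrix (Fin μ) (Fin μ) ℝ) ⊗ₖ (1 : Matrix (Fin n) (Fin n) ℝ)
    + ∑ j, L.coeff j ⊗ₖ X j

/-- `𝒟_L(n) = {X ∈ (𝕊ℝ^{n×n})^g : L(X) ≻ 0}`. -/
def MonicPencil.solutionSet {g μ : ℕ} (L : MonicPencil g μ) (n : ℕ) : Set (Tuple g n) :=
  {X | X ∈ symTuples g n ∧ (L.eval X).PosDef}

/-- `δ · ∑_{j=0}^k g^j`. -/
def wordCount (g δ k : ℕ) : ℕ := δ * ∑ j ∈ Finset.range (k + 1), g ^ j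

end FreeConvex

end

/-!
The positivity set `𝒟_p` is convex and contains `0`, so `X ∈ 𝒟_p` if and only if `p(tX) ≻ 0` for all
`t ∈ [0, 1]`. This description (`raySet`) passes to direct sums and to reducing subspaces. Averaging
`X` with its image under the reflection in a subspace then shows that it passes to all compressions
(`isMatrixConvex_raySet`); this is the only use of convexity beyond star-shapedness.

By the Effros–Winkler theorem (`exists_separating_pencil`), a tuple of `m × m` matrices outside
`𝒟_p` is separated from it by a pencil of size `m`. It is obtained by extending a positive
functional from a line, with respect to the cone of all pairs `(CᵀC, CᵀYC)`, `Y ∈ 𝒟_p`. Off a kernel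
the pencil can be made monic (`exists_monic_of_nonneg`).

A *boundary pair* `(X, v)` consists of a boundary point `X` and a vector `v ≠ 0` on which `p(X)` is
not positive. A monic pencil that is positive definite on `𝒟_p`, but at no `X` from a boundary pair,
has `𝒟_p` as its solution set: the ray to any other point crosses the boundary
(`exists_boundaryPair`).

To get a single pencil, fix `k` with `deg p ≤ 2k` and consider the vectors `q(X) v` for rows `q` of
polynomials of degree at most `k`, that is, the column space of the Krylov matrix `Ξ` of `(X, v)`.
Compressing `X` to this space preserves `⟨p(X) v, v⟩` (`quad_compress`), so the compression is still
outside `𝒟_p` and separation gives a pencil. Its value on a vector given by polynomials depends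
linearly on the moments `(ΞᵀΞ, ΞᵀX_jΞ)`, is nonnegative for all boundary pairs and vanishes for
`(X, v)`. Moments add up under direct sums, so `(X, v)` can be chosen such that any such functional
vanishes for all boundary pairs (`exists_dominating`). Hence one pencil fails to be positive
definite at every boundary pair `(Y, w)`, except when the rows entering the vector annihilate
`(Y, w)`. The exceptional pairs are treated in the same way, with a larger space `U` of annihilating
rows and hence a pencil of smaller size. The direct sum of these pencils has size at most
`N + (N - 1) + ⋯ + 1`, where `N` is the dimension of the space of rows (`exists_pencil_of_codim`).

The two size bounds are the cases `k = d` and `k = ⌈d/2⌉` of `exists_pencil_of_degree_le`.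
-/

/-! ### Evaluations and the quadratic form of a matrix polynomial -/

namespace FreeConvex

open Matrix

variable {g δ : ℕ} {ι κ : Type} [Fintype ι] [DecidableEq ι] [Fintype κ] [DecidableEq κ]

/-- A matrix `V` intertwining two tuples intertwines all their polynomials. -/
theorem lift_mul_of_intertwine {X : Fin g → Matrix ι ι ℝ} {Y : Fin g → Matrix κ κ ℝ}
    {V : Matrix ι κ ℝ} (h : ∀ j, X j * V = V * Y j) (a : NCPoly g) :
    FreeAlgebra.lift ℝ X a * V = V * FreeAlgebra.lift ℝ Y a := by
  induction a using FreeAlgebra.induction with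
  | grade0 r => simp [Algebra.algebraMap_eq_smul_one]
  | grade1 x => simpa using h x
  | mul a b ha hb => rw [map_mul, map_mul, Matrix.mul_assoc, hb, ← Matrix.mul_assoc, ha,
      Matrix.mul_assoc]
  | add a b ha hb => rw [map_add, map_add, Matrix.add_mul, ha, hb, Matrix.mul_add]

theorem lift_star {X : Fin g → Matrix ι ι ℝ} (hX : ∀ j, (X j).IsSymm) (a : NCPoly g) :
    FreeAlgebra.lift ℝ X (star a) = (FreeAlgebra.lift ℝ X a)ᵀ := by
  induction a using FreeAlgebra.induction with
  | grade0 r =>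
    rw [FreeAlgebra.star_algebraMap]
    simp [Algebra.algebraMap_eq_smul_one]
  | grade1 x => simpa using (hX x).symm
  | mul a b ha hb => simp [ha, hb]
  | add a b ha hb => simp [ha, hb]

theorem lift_fromBlocks (X : Fin g → Matrix ι ι ℝ) (Y : Fin g → Matrix κ κ ℝ) (a : NCPoly g) :
    FreeAlgebra.lift ℝ (fun j => fromBlocks (X j) 0 0 (Y j)) a =
      fromBlocks (FreeAlgebra.lift ℝ X a) 0 0 (FreeAlgebra.lift ℝ Y a) := by
  induction a using FreeAlgebra.induction with
  | grade0 r => simp [Algebra.algebraMap_eq_smul_one, ← fromBlocks_one, fromBlocks_smul]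
  | grade1 x => simp
  | mul a b ha hb => simp [ha, hb, fromBlocks_multiply]
  | add a b ha hb => simp [ha, hb, fromBlocks_add]

theorem continuous_lift_smul (X : Fin g → Matrix ι ι ℝ) (a : NCPoly g) :
    Continuous fun t : ℝ => FreeAlgebra.lift ℝ (t • X) a := by
  induction a using FreeAlgebra.induction with
  | grade0 r => simpa using continuous_const
  | grade1 x => 
    simp only [FreeAlgebra.lift_ι_apply, Pi.smul_apply]
    fun_prop
  | mul a b ha hb => simp only [map_mul]; fun_prop
  | add a b ha hb => simp only [map_add]; fun_prop

/-- The quadratic form `v ↦ ⟨p(X) v, v⟩`, the vector `v` being given by its `δ` blocks. -/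
def quad (p : MatPoly g δ) (X : Fin g → Matrix ι ι ℝ) (v : Fin δ → ι → ℝ) : ℝ :=
  ∑ i, ∑ j, v i ⬝ᵥ (FreeAlgebra.lift ℝ X (p i j) *ᵥ v j)

/-- `⟨p(X) v, v⟩ > 0` for every `v ≠ 0`. -/
def Pos (p : MatPoly g δ) (X : Fin g → Matrix ι ι ℝ) : Prop :=
  ∀ v : Fin δ → ι → ℝ, v ≠ 0 → 0 < quad p X v

theorem quad_smul (p : MatPoly g δ) (X : Fin g → Matrix ι ι ℝ) (c : ℝ) (v : Fin δ → ι → ℝ) :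
    quad p X (c • v) = c ^ 2 * quad p X v := by
  simp only [quad, Finset.mul_sum, Pi.smul_apply, mulVec_smul, dotProduct_smul, smul_dotProduct,
    smul_eq_mul]
  refine Finset.sum_congr rfl fun i _ => Finset.sum_congr rfl fun j _ => by ring

theorem quad_fromBlocks (p : MatPoly g δ) (X : Fin g → Matrix ι ι ℝ) (Y : Fin g → Matrix κ κ ℝ)
    (v : Fin δ → ι ⊕ κ → ℝ) :
    quad p (fun j => fromBlocks (X j) 0 0 (Y j)) v =
      quad p X (fun i => v i ∘ Sum.inl) + quad p Y (fun i => v i ∘ Sum.inr) := by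
  simp only [quad, ← Finset.sum_add_distrib, lift_fromBlocks]
  refine Finset.sum_congr rfl fun i _ => Finset.sum_congr rfl fun j _ => ?_
  rw [fromBlocks_mulVec]
  simp [dotProduct, Fintype.sum_sum_type]

theorem quad_of_intertwine (p : MatPoly g δ) {X : Fin g → Matrix ι ι ℝ}
    {Y : Fin g → Matrix κ κ ℝ} {V : Matrix ι κ ℝ} (h : ∀ j, X j * V = V * Y j)
    (hV : Vᵀ * V = 1) (v : Fin δ → κ → ℝ) :
    quad p X (fun i => V *ᵥ v i) = quad p Y v := by
  simp only [quad]
  refine Finset.sum_congr rfl fun i _ => Finset.sum_congr rfl fun j _ => ?_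
  rw [mulVec_mulVec, lift_mul_of_intertwine h, ← mulVec_mulVec, dotProduct_mulVec,
    vecMul_mulVec, hV, vecMul_one]

theorem Pos.of_intertwine {p : MatPoly g δ} {X : Fin g → Matrix ι ι ℝ}
    {Y : Fin g → Matrix κ κ ℝ} {V : Matrix ι κ ℝ} (hX : Pos p X) (h : ∀ j, X j * V = V * Y j)
    (hV : Vᵀ * V = 1) : Pos p Y := by
  intro v hv
  rw [← quad_of_intertwine p h hV]
  refine hX _ fun h0 => hv (funext fun i => ?_)
  have h1 : V *ᵥ v i = 0 := congrFun h0 i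
  simpa [hV] using congrArg (Vᵀ *ᵥ ·) h1

theorem Pos.fromBlocks {p : MatPoly g δ} {X : Fin g → Matrix ι ι ℝ}
    {Y : Fin g → Matrix κ κ ℝ} (hX : Pos p X) (hY : Pos p Y) :
    Pos p (fun j => fromBlocks (X j) 0 0 (Y j)) := by
  intro v hv
  rw [quad_fromBlocks]
  have nonneg : ∀ {ι : Type} [Fintype ι] [DecidableEq ι] {X : Fin g → Matrix ι ι ℝ}
      (_ : Pos p X) (w : Fin δ → ι → ℝ), 0 ≤ quad p X w := by
    intro ι _ _ X hX w
    by_cases hw : w = 0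
    · simp [hw, quad]
    · exact (hX w hw).le
  by_cases h1 : (fun i => v i ∘ Sum.inl) = 0
  · refine add_pos_of_nonneg_of_pos (nonneg hX _) (hY _ fun h2 => hv ?_)
    ext i a
    rcases a with a | a
    · exact congrFun (congrFun h1 i) a
    · exact congrFun (congrFun h2 i) a
  · exact add_pos_of_pos_of_nonneg (hX _ h1) (nonneg hY _)

/-- By compactness of the unit sphere, positivity of `p(tX)` is an open condition on `t`. -/
theorem isOpen_pos_smul (p : MatPoly g δ) (X : Fin g → Matrix ι ι ℝ) :
    IsOpen {t : ℝ | Pos p (t • X)} := by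
  have key : {t : ℝ | Pos p (t • X)} =
      {t : ℝ | ∀ v ∈ Metric.sphere (0 : Fin δ → ι → ℝ) 1, 0 < quad p (t • X) v} := by
    ext t
    refine ⟨fun h v hv => h v fun h0 => by simp [h0] at hv, fun h v hv => ?_⟩
    have hn : 0 < ‖v‖ := norm_pos_iff.2 hv
    have := h (‖v‖⁻¹ • v) (by simp [norm_smul, hn.ne'])
    rw [quad_smul] at this
    exact pos_of_mul_pos_right this (by positivity)
  have hc : Continuous fun z : ℝ × (Fin δ → ι → ℝ) => quad p (z.1 • X) z.2 := by
    unfold quad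
    refine continuous_finsetSum _ fun i _ => continuous_finsetSum _ fun j _ => ?_
    have h1 : Continuous fun z : ℝ × (Fin δ → ι → ℝ) => FreeAlgebra.lift ℝ (z.1 • X) (p i j) :=
      (continuous_lift_smul X (p i j)).comp continuous_fst
    exact Continuous.dotProduct (by fun_prop) (h1.matrix_mulVec (by fun_prop))
  rw [key, isOpen_iff_mem_nhds]
  intro t ht
  refine (isCompact_sphere _ _).eventually_forall_of_forall_eventually fun v hv => ?_
  exact hc.continuousAt.eventually (lt_mem_nhds (ht v hv))

theorem pos_zero {p : MatPoly g δ} (h0 : p.atZero.PosDef) :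
    Pos p (0 : Fin g → Matrix ι ι ℝ) := by
  intro v hv
  have hl : ∀ a : NCPoly g, FreeAlgebra.lift ℝ (0 : Fin g → Matrix ι ι ℝ) a =
      FreeAlgebra.lift ℝ (fun _ : Fin g => (0 : ℝ)) a • 1 := by
    intro a
    induction a using FreeAlgebra.induction with
    | grade0 r => simp [Algebra.algebraMap_eq_smul_one]
    | grade1 x => simp
    | mul a b ha hb => simp [ha, hb, smul_smul, mul_comm]
    | add a b ha hb => simp [ha, hb, add_smul]
  have hq : quad p (0 : Fin g → Matrix ι ι ℝ) v =
      ∑ a, (fun i => v i a) ⬝ᵥ (p.atZero *ᵥ fun i => v i a) := by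
    have h1 : ∀ i j, v i ⬝ᵥ (FreeAlgebra.lift ℝ (0 : Fin g → Matrix ι ι ℝ) (p i j) *ᵥ v j) =
        ∑ a, v i a * (p.atZero i j * v j a) := by
      intro i j
      rw [hl, smul_mulVec, one_mulVec, dotProduct]
      simp [MatPoly.atZero]
    simp only [quad, h1]
    simp only [dotProduct, mulVec, Finset.mul_sum]
    rw [Finset.sum_comm (s := (Finset.univ : Finset ι))]
    exact Finset.sum_congr rfl fun i _ => Finset.sum_comm
  rw [hq]
  have hne : ∃ a, (fun i => v i a) ≠ 0 := by
    by_contra! h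
    exact hv (by ext i a; exact congrFun (h a) i)
  obtain ⟨a, ha⟩ := hne
  refine Finset.sum_pos' (fun b _ => ?_) ⟨a, Finset.mem_univ _, ?_⟩
  · simpa using h0.posSemidef.dotProduct_mulVec_nonneg (fun i => v i b)
  · simpa using h0.dotProduct_mulVec_pos ha

/-- For symmetric `p` and `X`, the matrix `p(X)` is positive definite if and only if its quadratic
form is positive. -/
theorem eval_posDef_iff {n : ℕ} {p : MatPoly g δ} (hp : p.IsHermitian) {X : Tuple g n}
    (hX : ∀ j, (X j).IsSymm) : (p.eval X).PosDef ↔ Pos p X := by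
  have hq : ∀ v : Fin δ → Fin n → ℝ,
      quad p X v = (fun z : Fin δ × Fin n => v z.1 z.2) ⬝ᵥ
        (p.eval X *ᵥ fun z : Fin δ × Fin n => v z.1 z.2) := by
    intro v
    simp only [quad, dotProduct, mulVec, Fintype.sum_prod_type, MatPoly.eval, Finset.mul_sum,
      comp_apply, map_apply]
    refine Finset.sum_congr rfl fun i _ => ?_
    rw [Finset.sum_comm]
  rw [posDef_iff_dotProduct_mulVec]
  constructor
  · rintro ⟨-, h⟩ v hv
    rw [hq]
    refine h fun h0 => hv ?_
    ext i a
    exact congrFun h0 (i, a)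
  · intro h
    refine ⟨?_, fun x hx => ?_⟩
    · ext ⟨i, a⟩ ⟨j, b⟩
      have h1 : star (p j i) = p i j := hp.apply i j
      have h2 := lift_star hX (p j i)
      rw [h1] at h2
      simpa [MatPoly.eval, comp_apply] using (congrFun (congrFun h2 a) b).symm
    · have := h (fun i a => x (i, a)) fun h0 => hx (by
        ext ⟨i, a⟩; exact congrFun (congrFun h0 i) a)
      rw [hq] at this
      simpa using this

/-! ### Matrix convex sets -/

/-- Graded sets of tuples of symmetric matrices, indexed by all finite types, that are star-shaped
about `0`, absorbing, open along rays and closed under direct sums and compressions. -/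
structure IsMatrixConvex
    (K : ∀ (ι : Type) [Fintype ι] [DecidableEq ι], Set (Fin g → Matrix ι ι ℝ)) : Prop where
  symm : ∀ {ι : Type} [Fintype ι] [DecidableEq ι] {X : Fin g → Matrix ι ι ℝ},
    X ∈ K ι → ∀ j, (X j).IsSymm
  zero_mem : ∀ (ι : Type) [Fintype ι] [DecidableEq ι], (0 : Fin g → Matrix ι ι ℝ) ∈ K ι
  smul_mem : ∀ {ι : Type} [Fintype ι] [DecidableEq ι] {X : Fin g → Matrix ι ι ℝ} {t : ℝ},
    X ∈ K ι → 0 ≤ t → t ≤ 1 → t • X ∈ K ι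
  exists_smul_mem : ∀ {ι : Type} [Fintype ι] [DecidableEq ι] {X : Fin g → Matrix ι ι ℝ},
    (∀ j, (X j).IsSymm) → ∃ ε > (0 : ℝ), ε • X ∈ K ι
  exists_one_lt_smul_mem : ∀ {ι : Type} [Fintype ι] [DecidableEq ι] {X : Fin g → Matrix ι ι ℝ},
    X ∈ K ι → ∃ t > (1 : ℝ), t • X ∈ K ι
  directSum_mem : ∀ {ι κ : Type} [Fintype ι] [DecidableEq ι] [Fintype κ] [DecidableEq κ]
    {X : Fin g → Matrix ι ι ℝ} {Y : Fin g → Matrix κ κ ℝ}, X ∈ K ι → Y ∈ K κ →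
    (fun j => fromBlocks (X j) 0 0 (Y j)) ∈ K (ι ⊕ κ)
  compress_mem : ∀ {ι κ : Type} [Fintype ι] [DecidableEq ι] [Fintype κ] [DecidableEq κ]
    {X : Fin g → Matrix ι ι ℝ} {V : Matrix ι κ ℝ}, X ∈ K ι → Vᵀ * V = 1 →
    (fun j => Vᵀ * X j * V) ∈ K κ

/-- The symmetric tuples `X` for which `p` is positive along the whole segment from `0` to `X`. When
the positivity sets of `p` are convex these are the elements of `𝒟_p`, and the description makes
sense for matrices indexed by any finite type. -/
def raySet (p : MatPoly g δ) (ι : Type) [Fintype ι] [DecidableEq ι] :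
    Set (Fin g → Matrix ι ι ℝ) :=
  {X | (∀ j, (X j).IsSymm) ∧ ∀ t ∈ Set.Icc (0 : ℝ) 1, Pos p (t • X)}

/-- `raySet p` is closed under unitary conjugation and under restriction to reducing subspaces. -/
theorem of_intertwine_mem_raySet {p : MatPoly g δ} {X : Fin g → Matrix ι ι ℝ}
    {Y : Fin g → Matrix κ κ ℝ} {V : Matrix ι κ ℝ} (hX : X ∈ raySet p ι)
    (hY : ∀ j, (Y j).IsSymm) (h : ∀ j, X j * V = V * Y j) (hV : Vᵀ * V = 1) :
    Y ∈ raySet p κ :=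
  ⟨hY, fun t ht => (hX.2 t ht).of_intertwine (V := V) (fun j => by simp [h]) hV⟩

/-- Renaming the indices identifies `raySet p ι` with its version over `Fin n`. -/
theorem exists_mem_raySet_iff_fin (ι : Type) [Fintype ι] [DecidableEq ι] :
    ∃ f : (Fin g → Matrix ι ι ℝ) →ₗ[ℝ] Tuple g (Fintype.card ι),
      ∀ (p : MatPoly g δ) X, X ∈ raySet p ι ↔ f X ∈ raySet p (Fin (Fintype.card ι)) := by
  let e := Fintype.equivFin ι
  refine ⟨LinearMap.pi fun j => (reindexLinearEquiv ℝ ℝ e e).toLinearMap ∘ₗ LinearMap.proj j,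
    fun p X => ⟨fun h => ?_, fun h => ?_⟩⟩
  · refine of_intertwine_mem_raySet h (V := (1 : Matrix ι ι ℝ).submatrix id e.symm)
      (fun j => by simpa using (h.1 j).submatrix _) (fun j => ?_) ?_
    · ext a b
      rw [mul_apply, mul_apply, Finset.sum_eq_single (e.symm b), Finset.sum_eq_single (e a)] <;>
        simp +contextual [one_apply, Equiv.eq_symm_apply, eq_comm]
    · ext a b; simp [mul_apply, one_apply]
  · have hs : ∀ j, (X j).IsSymm := fun j => by
      have := (h.1 j).submatrix e
      simpa using this
    refine of_intertwine_mem_raySet h (V := (1 : Matrix ι ι ℝ).submatrix e.symm id) hs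
      (fun j => ?_) ?_
    · ext a b
      rw [mul_apply, mul_apply, Finset.sum_eq_single (e b), Finset.sum_eq_single (e.symm a)] <;>
        simp +contextual [one_apply, Equiv.symm_apply_eq, Ne.symm]
    · ext a b; simp [mul_apply, one_apply, ← Equiv.eq_symm_apply]

/-- If all `raySet p (Fin n)` are convex, so is `raySet p ι` for every finite `ι`. -/
theorem convex_raySet {p : MatPoly g δ} (hc : ∀ n, Convex ℝ (raySet p (Fin n)))
    (ι : Type) [Fintype ι] [DecidableEq ι] : Convex ℝ (raySet p ι) := by
  obtain ⟨f, hf⟩ := exists_mem_raySet_iff_fin (g := g) (δ := δ) ι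
  have : raySet p ι = f ⁻¹' raySet p (Fin (Fintype.card ι)) := Set.ext fun X => hf p X
  rw [this]
  exact (hc _).linear_preimage f

theorem isMatrixConvex_raySet {p : MatPoly g δ} (h0 : p.atZero.PosDef)
    (hc : ∀ n, Convex ℝ (raySet p (Fin n))) : IsMatrixConvex (fun ι => raySet p ι) where
  symm h := h.1
  zero_mem ι := ⟨fun j => by simp, fun t _ => by simpa using pos_zero h0⟩
  smul_mem {ι _ _ X t} h h1 h2 := by
    refine ⟨fun j => (h.1 j).smul t, fun s hs => ?_⟩
    rw [smul_smul]
    exact h.2 _ ⟨mul_nonneg hs.1 h1, mul_le_one₀ hs.2 h1 h2⟩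
  exists_smul_mem {ι _ _ X} hX := by
    have h1 : {t : ℝ | Pos p (t • X)} ∈ nhds (0 : ℝ) :=
      (isOpen_pos_smul p X).mem_nhds (by simpa using pos_zero h0)
    obtain ⟨ε, hε, hb⟩ := Metric.mem_nhds_iff.1 h1
    refine ⟨ε / 2, by positivity, fun j => (hX j).smul (ε / 2), fun t ht => ?_⟩
    rw [smul_smul]
    apply hb
    rw [Metric.mem_ball, dist_zero_right, Real.norm_eq_abs, abs_of_nonneg
      (mul_nonneg ht.1 (by positivity))]
    nlinarith [ht.1, ht.2]
  exists_one_lt_smul_mem {ι _ _ X} h := by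
    have h1 : {t : ℝ | Pos p (t • X)} ∈ nhds (1 : ℝ) :=
      (isOpen_pos_smul p X).mem_nhds (h.2 1 (by simp))
    obtain ⟨ε, hε, hb⟩ := Metric.mem_nhds_iff.1 h1
    refine ⟨1 + ε / 2, by linarith, fun j => (h.1 j).smul (1 + ε / 2), fun t ht => ?_⟩
    rw [smul_smul]
    by_cases h2 : t * (1 + ε / 2) ≤ 1
    · exact h.2 _ ⟨mul_nonneg ht.1 (by positivity), h2⟩
    · apply hb
      rw [Metric.mem_ball, Real.dist_eq, abs_of_pos (by linarith)]
      nlinarith [ht.1, ht.2]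
  directSum_mem {ι κ _ _ _ _ X Y} hX hY := by
    refine ⟨fun j => (hX.1 j).fromBlocks (by simp) (hY.1 j), fun t ht => ?_⟩
    have := (hX.2 t ht).fromBlocks (hY.2 t ht)
    convert this using 2 with j
    simp [fromBlocks_smul]
  compress_mem {ι κ _ _ _ _ X V} hX hV := by
    -- Averaging `X` with its image under the reflection `2VVᵀ - 1` gives a tuple that is reduced
    -- by the range of `V` and has the same compression.
    set P : Matrix ι ι ℝ := V * Vᵀ with hP
    have hPV : P * V = V := by rw [hP, Matrix.mul_assoc, hV, Matrix.mul_one]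
    have hPt : Pᵀ = P := by simp [hP]
    have hPP : P * P = P := by
      rw [hP, Matrix.mul_assoc, ← Matrix.mul_assoc Vᵀ, hV, Matrix.one_mul]
    set R : Matrix ι ι ℝ := (2 : ℝ) • P - 1 with hR
    have hRt : Rᵀ = R := by simp [hR, hPt]
    have hRR : R * R = 1 := by
      simp only [hR, Matrix.sub_mul, Matrix.mul_sub, hPP, smul_mul_smul_comm, Matrix.mul_one,
        Matrix.one_mul]
      module
    have hRV : R * V = V := by
      simp only [hR, Matrix.sub_mul, Matrix.smul_mul, hPV, Matrix.one_mul]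
      module
    have hY : (fun j => R * X j * R) ∈ raySet p ι := by
      refine of_intertwine_mem_raySet hX (V := R) (fun j => ?_) (fun j => ?_) (by rw [hRt, hRR])
      · simp [IsSymm, transpose_mul, hRt, (hX.1 j).eq, Matrix.mul_assoc]
      · rw [← Matrix.mul_assoc, ← Matrix.mul_assoc, hRR, Matrix.one_mul]
    have hZ := (convex_raySet hc ι) hX hY (a := 1 / 2) (b := 1 / 2) (by norm_num) (by norm_num)
      (by norm_num)
    refine of_intertwine_mem_raySet hZ (V := V) (fun j => ?_) (fun j => ?_) hV
    · simp [IsSymm, transpose_mul, (hX.1 j).eq, Matrix.mul_assoc]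
    · have : (1 / 2 : ℝ) • X j + (1 / 2 : ℝ) • (R * X j * R) =
          P * X j * P + (1 - P) * X j * (1 - P) := by
        simp only [hR, Matrix.sub_mul, Matrix.mul_sub, Matrix.smul_mul, Matrix.mul_smul,
          Matrix.mul_one, Matrix.one_mul]
        module
      simp only [Pi.add_apply, Pi.smul_apply, this]
      have h1PV : (1 - P) * V = 0 := by rw [Matrix.sub_mul, hPV, Matrix.one_mul, sub_self]
      rw [Matrix.add_mul, Matrix.mul_assoc _ P, hPV, Matrix.mul_assoc _ (1 - P), h1PV,
        Matrix.mul_zero, add_zero, hP]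
      simp only [Matrix.mul_assoc]

end FreeConvex

/-! ### Linear algebra -/

namespace FreeConvex

open Matrix

variable {g : ℕ} {ι κ m : Type} [Fintype ι] [DecidableEq ι] [Fintype κ] [DecidableEq κ]
  [Fintype m] [DecidableEq m]

/-- A positive semidefinite `T` is congruent to an identity matrix on a complement of its kernel:
the columns of `H` are the eigenvectors for nonzero eigenvalues, scaled. -/
theorem exists_normalizing_factor {T : Matrix m m ℝ} (hT : T.PosSemidef) :
    ∃ (κ : Type) (_ : Fintype κ) (_ : DecidableEq κ) (H : Matrix m κ ℝ),
      Hᵀ * T * H = 1 ∧ T * H * Hᵀ * T = T := by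
  classical
  let d := hT.isHermitian.eigenvalues
  let U : Matrix m m ℝ := hT.isHermitian.eigenvectorUnitary
  have hU : Uᵀ * U = 1 := by
    have := Unitary.coe_star_mul_self hT.isHermitian.eigenvectorUnitary
    simpa [star_eq_conjTranspose] using this
  have hspec : T = U * diagonal d * Uᵀ := by
    have := hT.isHermitian.spectral_theorem
    rw [Unitary.conjStarAlgAut_apply] at this
    simpa [star_eq_conjTranspose, d, U, Function.comp_def] using this
  have hd : ∀ i, 0 ≤ d i := hT.eigenvalues_nonneg
  -- `1 / √0 = 0`, so `D S² D = D` holds without a case distinction on the indices.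
  let S : Matrix m m ℝ := diagonal fun i => (√(d i))⁻¹
  let E : Matrix m {i // d i ≠ 0} ℝ := S.submatrix id (↑)
  have hs : ∀ i, d i ≠ 0 → √(d i) ≠ 0 := fun i hi =>
    Real.sqrt_ne_zero'.2 (lt_of_le_of_ne (hd i) (Ne.symm hi))
  have hE1 : Eᵀ * diagonal d * E = 1 := by
    have h1 : Eᵀ * diagonal d * E = (S * diagonal d * S).submatrix (↑) (↑) := by
      rw [submatrix_mul _ _ _ id _ Function.bijective_id,
        submatrix_mul _ _ _ id _ Function.bijective_id]
      simp [E, S]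
    rw [h1]
    ext i j
    simp only [S, diagonal_mul_diagonal, submatrix_apply, diagonal_apply, one_apply,
      Subtype.ext_iff]
    refine if_congr Iff.rfl ?_ rfl
    have h2 := hs i i.2
    have h3 := Real.sq_sqrt (hd i)
    field_simp
    exact h3.symm
  have hE2 : diagonal d * E * Eᵀ * diagonal d = diagonal d := by
    have h1 : E * Eᵀ = S * S := by
      ext i j
      have h2 := (Finset.sum_subtype (p := fun k => d k ≠ 0) (F := inferInstance)
        (Finset.univ.filter fun k => d k ≠ 0) (by simp) (fun k => S i k * S j k)).symm
      rw [Finset.sum_filter_of_ne (p := fun k => d k ≠ 0) fun k _ hk hdk => hk (by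
        rcases eq_or_ne i k with rfl | h <;> simp [S, *])] at h2
      refine h2.trans ?_
      rw [mul_apply]
      exact Finset.sum_congr rfl fun k _ => by rw [← transpose_apply S k j, diagonal_transpose]
    rw [Matrix.mul_assoc (diagonal d), h1]
    simp only [S, diagonal_mul_diagonal]
    congr 1
    ext i
    by_cases hi : d i = 0
    · simp [hi]
    · have h2 := hs i hi
      have h3 := Real.sq_sqrt (hd i)
      field_simp
      exact h3.symm
  refine ⟨{i // d i ≠ 0}, inferInstance, inferInstance, U * E, ?_, ?_⟩
  · calc (U * E)ᵀ * T * (U * E) = Eᵀ * (Uᵀ * U) * diagonal d * (Uᵀ * U) * E := by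
          rw [hspec, transpose_mul]; simp only [Matrix.mul_assoc]
      _ = 1 := by rw [hU, Matrix.mul_one, Matrix.mul_one, hE1]
  · calc T * (U * E) * (U * E)ᵀ * T
        = U * (diagonal d * (Uᵀ * U) * E * Eᵀ * (Uᵀ * U) * diagonal d) * Uᵀ := by
          rw [hspec, transpose_mul]; simp only [Matrix.mul_assoc]
      _ = T := by rw [hU, Matrix.mul_one, Matrix.mul_one, hE2, ← hspec]

/-- The columns of `H` are independent modulo the kernel of `T`. -/
theorem card_add_finrank_le {m : Type} [Fintype m] {T : Matrix m m ℝ} {H : Matrix m κ ℝ}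
    (hH : Hᵀ * T * H = 1)
    (U : Submodule ℝ (m → ℝ)) (hU : ∀ u ∈ U, T *ᵥ u = 0) :
    Fintype.card κ + Module.finrank ℝ U ≤ Fintype.card m := by
  have hinj : Function.Injective H.mulVecLin := by
    intro x y hxy
    have h := congrArg ((Hᵀ * T) *ᵥ ·) hxy
    simpa [hH] using h
  have hdisj : Disjoint (LinearMap.range H.mulVecLin) U := by
    rw [Submodule.disjoint_def]
    rintro _ ⟨x, rfl⟩ hx
    have h1 : Hᵀ *ᵥ (T *ᵥ (H *ᵥ x)) = 0 := by
      rw [show T *ᵥ (H *ᵥ x) = 0 from hU _ hx, mulVec_zero]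
    rw [mulVec_mulVec, mulVec_mulVec, hH, one_mulVec] at h1
    simp [h1]
  have h1 := LinearMap.finrank_range_of_inj hinj
  rw [Module.finrank_fintype_fun_eq_card] at h1
  have h2 := Submodule.finrank_add_finrank_le_of_disjoint hdisj
  rwa [h1, Module.finrank_fintype_fun_eq_card] at h2

/-- A set closed under addition in a finite-dimensional space contains a point `a` such that every
functional that is nonnegative on the set and vanishes at `a` vanishes on the whole set. The sum of
a finite spanning subset is such a point. -/
theorem exists_dominating {F : Type*} [AddCommGroup F] [Module ℝ F] [FiniteDimensional ℝ F]
    {A : Set F} (hne : A.Nonempty) (hadd : ∀ a ∈ A, ∀ b ∈ A, a + b ∈ A) :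
    ∃ a ∈ A, ∀ ψ : F →ₗ[ℝ] ℝ, (∀ b ∈ A, 0 ≤ ψ b) → ψ a = 0 → ∀ b ∈ A, ψ b = 0 := by
  classical
  obtain ⟨s, hsA, hs⟩ : ∃ s : Finset F, ↑s ⊆ A ∧
      Submodule.span ℝ (s : Set F) = Submodule.span ℝ A :=
    Submodule.fg_span_iff_fg_span_finset_subset A |>.1 (IsNoetherian.noetherian _)
      |>.imp fun s h => ⟨h.1, h.2.symm⟩
  have hsum : ∀ t : Finset F, ↑t ⊆ A → ∃ a ∈ A, ∀ ψ : F →ₗ[ℝ] ℝ, (∀ b ∈ A, 0 ≤ ψ b) → ψ a = 0 →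
      ∀ b ∈ t, ψ b = 0 := by
    intro t
    induction t using Finset.induction_on with
    | empty => exact fun _ => ⟨hne.some, hne.some_mem, by simp⟩
    | insert x t hx ih =>
      intro h
      rw [Finset.coe_insert, Set.insert_subset_iff] at h
      obtain ⟨a, ha, hψ⟩ := ih h.2
      refine ⟨x + a, hadd _ h.1 _ ha, fun ψ hpos h0 b hb => ?_⟩
      rw [map_add] at h0
      have h1 := hpos x h.1
      have h2 := hpos a ha
      rcases Finset.mem_insert.1 hb with rfl | hb
      · linarith
      · exact hψ ψ hpos (by linarith) b hb
  obtain ⟨a, ha, hψ⟩ := hsum s hsA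
  refine ⟨a, ha, fun ψ hpos h0 b hb => ?_⟩
  have hle : Submodule.span ℝ (s : Set F) ≤ LinearMap.ker ψ :=
    Submodule.span_le.2 fun c hc => hψ ψ hpos h0 c hc
  exact hle (hs ▸ Submodule.subset_span hb)

/-- Every linear functional on symmetric matrices is `S ↦ tr(TS)` for a symmetric `T`. -/
theorem exists_symm_trace (ψ : Matrix m m ℝ →ₗ[ℝ] ℝ) :
    ∃ T : Matrix m m ℝ, T.IsSymm ∧ ∀ S : Matrix m m ℝ, S.IsSymm → ψ S = (T * S).trace := by
  let T0 : Matrix m m ℝ := of fun a b => ψ (Matrix.single a b 1)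
  have h0 : ∀ S, ψ S = (T0ᵀ * S).trace := by
    intro S
    conv_lhs => rw [matrix_eq_sum_single S]
    simp only [map_sum, trace, diag_apply, mul_apply, transpose_apply, T0, of_apply]
    rw [Finset.sum_comm]
    refine Finset.sum_congr rfl fun a _ => Finset.sum_congr rfl fun b _ => ?_
    rw [← mul_one (S b a), ← smul_eq_mul (S b a) 1, ← smul_single, map_smul, smul_eq_mul,
      smul_eq_mul, mul_one, mul_comm]
  refine ⟨(1 / 2 : ℝ) • (T0 + T0ᵀ), ?_, fun S hS => ?_⟩
  · simp [IsSymm, add_comm]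
  · have h1 : (T0 * S).trace = (T0ᵀ * S).trace := by
      rw [← trace_transpose, transpose_mul, hS.eq, trace_mul_comm]
    rw [h0, Matrix.smul_mul, trace_smul, Matrix.add_mul, trace_add, h1, smul_eq_mul]
    ring

theorem exists_posSemidef_add_smul_one {S : Matrix m m ℝ} (hS : S.IsSymm) :
    ∃ c : ℝ, ∀ b, c ≤ b → (S + b • (1 : Matrix m m ℝ)).PosSemidef := by
  refine ⟨∑ i, ∑ j, |S i j|, fun b hb => .of_dotProduct_mulVec_nonneg ?_ fun x => ?_⟩
  · simp [IsHermitian, hS.eq]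
  · have hx : ∀ i j, -(|S i j| * (x ⬝ᵥ x)) ≤ x i * (S i j * x j) := by
      intro i j
      have h1 : ∀ i, x i ^ 2 ≤ x ⬝ᵥ x := fun i => by
        rw [sq]
        exact Finset.single_le_sum (f := fun i => x i * x i) (fun i _ => mul_self_nonneg _)
          (Finset.mem_univ i)
      have h2 : |x i * x j| ≤ x ⬝ᵥ x := by
        rw [abs_le]
        constructor <;> nlinarith [h1 i, h1 j, sq_nonneg (x i + x j), sq_nonneg (x i - x j)]
      have h3 : |x i * (S i j * x j)| ≤ |S i j| * (x ⬝ᵥ x) := by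
        rw [show x i * (S i j * x j) = S i j * (x i * x j) by ring, abs_mul]
        gcongr
      exact (abs_le.1 h3).1
    have h4 : -((∑ i, ∑ j, |S i j|) * (x ⬝ᵥ x)) ≤ x ⬝ᵥ (S *ᵥ x) := by
      have h5 : x ⬝ᵥ (S *ᵥ x) = ∑ i, ∑ j, x i * (S i j * x j) := by
        simp [dotProduct, mulVec, Finset.mul_sum]
      rw [h5]
      simp only [Finset.sum_mul, ← Finset.sum_neg_distrib]
      exact Finset.sum_le_sum fun i _ => Finset.sum_le_sum fun j _ => hx i j
    have h5 : 0 ≤ x ⬝ᵥ x := Finset.sum_nonneg fun i _ => mul_self_nonneg _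
    simp only [star_trivial, add_mulVec, smul_mulVec, one_mulVec, dotProduct_add, dotProduct_smul,
      smul_eq_mul]
    nlinarith

theorem exists_eq_transpose_mul_self {S : Matrix m m ℝ} (hS : S.PosSemidef) :
    ∃ C : Matrix m m ℝ, S = Cᵀ * C := by
  open scoped MatrixOrder Matrix.Norms.L2Operator in
  obtain ⟨B, hB⟩ := CStarAlgebra.nonneg_iff_eq_star_mul_self.1 (Matrix.nonneg_iff_posSemidef.2 hS)
  exact ⟨B, by simpa [star_eq_conjTranspose] using hB⟩

/-! ### Separation from matrix convex sets -/

/-- The value of the pencil `T ⊗ 1 + ∑ β_j ⊗ Y_j` on the vector with matrix `C`, that is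
`tr(T CᵀC) + ∑ tr(β_j CᵀY_jC)`. -/
def pform (T : Matrix m m ℝ) (β : Fin g → Matrix m m ℝ) (Y : Fin g → Matrix ι ι ℝ)
    (C : Matrix ι m ℝ) : ℝ :=
  (T * (Cᵀ * C)).trace + ∑ j, (β j * (Cᵀ * Y j * C)).trace

/-- The pairs `(CᵀC, CᵀYC)` with `Y ∈ K`, up to antisymmetric parts and up to adding nonnegative
multiples of `-(1, X)`. -/
def separationCone {K : ∀ (ι : Type) [Fintype ι] [DecidableEq ι], Set (Fin g → Matrix ι ι ℝ)}
    (hK : IsMatrixConvex K) (X : Fin g → Matrix m m ℝ) :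
    PointedCone ℝ (Matrix m m ℝ × (Fin g → Matrix m m ℝ)) where
  carrier := {P | ∃ (ι : Type) (_ : Fintype ι) (_ : DecidableEq ι), ∃ Y ∈ K ι,
    ∃ (C : Matrix ι m ℝ) (b : ℝ), 0 ≤ b ∧ P.1 + P.1ᵀ + b • 1 = Cᵀ * C ∧
      ∀ j, P.2 j + (P.2 j)ᵀ + b • X j = Cᵀ * Y j * C}
  zero_mem' := ⟨m, inferInstance, inferInstance, 0, hK.zero_mem m, 0, 0, le_rfl, by simp, by simp⟩
  add_mem' := by
    rintro ⟨S, Z⟩ ⟨S', Z'⟩ ⟨ι, _, _, Y, hY, C, b, hb, h1, h2⟩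
      ⟨ι', _, _, Y', hY', C', b', hb', h1', h2'⟩
    refine ⟨ι ⊕ ι', inferInstance, inferInstance, _, hK.directSum_mem hY hY', fromRows C C', b + b',
      by positivity, ?_, fun j => ?_⟩
    · rw [transpose_fromRows, fromCols_mul_fromRows, ← h1, ← h1']
      simp only [Prod.mk_add_mk, transpose_add, add_smul]
      abel
    · rw [transpose_fromRows, fromCols_mul_fromBlocks, fromCols_mul_fromRows]
      simp only [Matrix.mul_zero, add_zero, zero_add, ← h2, ← h2', Prod.mk_add_mk, Pi.add_apply,
        transpose_add, add_smul]
      abel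
  smul_mem' := by
    rintro ⟨c, hc⟩ ⟨S, Z⟩ ⟨ι, _, _, Y, hY, C, b, hb, h1, h2⟩
    have hs := Real.mul_self_sqrt hc
    refine ⟨ι, inferInstance, inferInstance, Y, hY, √c • C, c * b, by positivity, ?_, fun j => ?_⟩
    · simp only [transpose_smul, Matrix.smul_mul, Matrix.mul_smul, smul_smul, hs, ← h1]
      simp [smul_add, smul_smul]
    · simp only [transpose_smul, Matrix.smul_mul, Matrix.mul_smul, smul_smul, hs, ← h2]
      simp [smul_add, smul_smul]

/-- If `(c, bX)` is a point `(CᵀC, CᵀYC)` with `Y ∈ K` and `c < b`, then `X ∈ K`: for `c > 0` the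
matrix `C / √c` is an isometry. -/
theorem mem_of_smul_eq_compress
    {K : ∀ (ι : Type) [Fintype ι] [DecidableEq ι], Set (Fin g → Matrix ι ι ℝ)}
    (hK : IsMatrixConvex K) {X : Fin g → Matrix m m ℝ} {Y : Fin g → Matrix ι ι ℝ} (hY : Y ∈ K ι)
    {C : Matrix ι m ℝ} {c b : ℝ} (hc : 0 ≤ c) (hcb : c < b) (h1 : c • 1 = Cᵀ * C)
    (h2 : ∀ j, b • X j = Cᵀ * Y j * C) : X ∈ K m := by
  have hb : 0 < b := hc.trans_lt hcb
  rcases hc.eq_or_lt with rfl | hc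
  · have hC : C = 0 := by
      rw [zero_smul] at h1
      exact (trace_conjTranspose_mul_self_eq_zero_iff (A := C)).1 (by simp [← h1])
    have : X = 0 := by
      ext1 j
      have := h2 j
      rw [hC, Matrix.mul_zero] at this
      exact (smul_eq_zero.1 this).resolve_left hb.ne'
    exact this ▸ hK.zero_mem m
  · have hV : ((√c)⁻¹ • C)ᵀ * ((√c)⁻¹ • C) = 1 := by
      rw [transpose_smul, Matrix.smul_mul, Matrix.mul_smul, ← h1, smul_smul, smul_smul, ← mul_inv,
        Real.mul_self_sqrt hc.le, inv_mul_cancel₀ hc.ne', one_smul]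
    have h3 := hK.smul_mem (hK.compress_mem hY hV) (t := c / b) (by positivity)
      ((div_le_one hb).2 hcb.le)
    convert h3 using 1
    ext1 j
    rw [Pi.smul_apply, transpose_smul, Matrix.smul_mul, Matrix.smul_mul, Matrix.mul_smul, ← h2,
      smul_smul, smul_smul,
      smul_smul, show c / b * (√c)⁻¹ * (√c)⁻¹ * b = c / b * (√c * √c)⁻¹ * b by
        rw [mul_inv]; ring, Real.mul_self_sqrt hc.le, show c / b * c⁻¹ * b = 1 by field_simp,
      one_smul]

/-- The Effros–Winkler separation theorem: a tuple of `m × m` matrices outside a matrix convex set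
is separated from it by a linear pencil of size `m`, evaluated on the vector with matrix `1`. -/
theorem exists_separating_pencil
    {K : ∀ (ι : Type) [Fintype ι] [DecidableEq ι], Set (Fin g → Matrix ι ι ℝ)}
    (hK : IsMatrixConvex K) {X : Fin g → Matrix m m ℝ} (hX : ∀ j, (X j).IsSymm) (hXK : X ∉ K m) :
    ∃ (T : Matrix m m ℝ) (β : Fin g → Matrix m m ℝ), T.IsSymm ∧ (∀ j, (β j).IsSymm) ∧
      T.trace = 1 ∧ pform T β X 1 ≤ 0 ∧
      ∀ (ι : Type) [Fintype ι] [DecidableEq ι], ∀ Y ∈ K ι, ∀ C : Matrix ι m ℝ,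
        0 ≤ pform T β Y C := by
  have hm : Nonempty m := by
    by_contra h
    rw [not_nonempty_iff] at h
    exact hXK (Subsingleton.elim 0 X ▸ hK.zero_mem m)
  have hne : ((1 : Matrix m m ℝ), (0 : Fin g → Matrix m m ℝ)) ≠ 0 := fun h =>
    one_ne_zero (congrArg Prod.fst h)
  obtain ⟨φ, hφ1, hφ2⟩ := riesz_extension (separationCone hK X)
    (LinearPMap.mkSpanSingleton ((1 : Matrix m m ℝ), (0 : Fin g → Matrix m m ℝ)) (1 : ℝ) hne)
    -- The functional `a • (1, 0) ↦ a` is nonnegative on the cone: otherwise `X ∈ K`.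
    (by
      rintro ⟨x, hx⟩ hxs
      obtain ⟨a, rfl⟩ := Submodule.mem_span_singleton.1 hx
      have hval := LinearPMap.mkSpanSingleton'_apply (R := ℝ)
        ((1 : Matrix m m ℝ), (0 : Fin g → Matrix m m ℝ)) (1 : ℝ)
        (fun c hc => by simpa [hne] using hc) a hx
      refine le_of_le_of_eq ?_ hval.symm
      obtain ⟨ι, _, _, Y, hY, C, b, hb, h1, h2⟩ := hxs
      by_contra ha
      simp only [RingHom.id_apply, smul_eq_mul, mul_one, not_le] at ha
      have h1' : (2 * a + b) • (1 : Matrix m m ℝ) = Cᵀ * C := by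
        rw [← h1]
        simp only [Prod.smul_mk, transpose_smul, transpose_one]
        module
      refine hXK (mem_of_smul_eq_compress hK hY (c := 2 * a + b) (b := b) ?_ (by linarith) h1'
        fun j => by simpa using h2 j)
      have i := hm.some
      have h3 := congrFun (congrFun h1' i) i
      simp only [Matrix.smul_apply, one_apply_eq, smul_eq_mul, mul_one, mul_apply,
        transpose_apply] at h3
      rw [h3]
      exact Finset.sum_nonneg fun _ _ => mul_self_nonneg _)
    -- The line meets every translate of the cone, as `K` is absorbing.
    (by
      rintro ⟨S, Z⟩
      obtain ⟨ε, hε, hZ⟩ := hK.exists_smul_mem (X := fun j => Z j + (Z j)ᵀ)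
        (fun j => by simp [IsSymm, add_comm])
      obtain ⟨c, hc⟩ := exists_posSemidef_add_smul_one (S := S + Sᵀ) (by simp [IsSymm, add_comm])
      obtain ⟨C, hC⟩ := exists_eq_transpose_mul_self (hc c le_rfl)
      let a := (c + ε⁻¹) / 2
      refine ⟨⟨a • ((1 : Matrix m m ℝ), (0 : Fin g → Matrix m m ℝ)),
        Submodule.smul_mem _ _ (Submodule.mem_span_singleton_self _)⟩, ?_⟩
      refine ⟨m ⊕ m, inferInstance, inferInstance, _, hK.directSum_mem (hK.zero_mem m) hZ,
        fromRows C ((√ε)⁻¹ • 1), 0, le_rfl, ?_, fun j => ?_⟩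
      · rw [transpose_fromRows, fromCols_mul_fromRows, ← hC]
        simp only [transpose_smul, transpose_one, Matrix.mul_smul, Matrix.mul_one, smul_smul,
          ← mul_inv, Real.mul_self_sqrt hε.le, Prod.smul_mk, Prod.mk_add_mk, transpose_add, a]
        module
      · rw [transpose_fromRows, fromCols_mul_fromBlocks, fromCols_mul_fromRows]
        simp only [Pi.zero_apply, Matrix.mul_zero, Matrix.zero_mul, add_zero, zero_add,
          transpose_smul, transpose_one, Matrix.smul_mul, Matrix.mul_smul, Matrix.mul_one,
          Matrix.one_mul, Pi.smul_apply, smul_smul, Prod.smul_mk, Prod.mk_add_mk, smul_zero,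
          zero_smul]
        rw [show (√ε)⁻¹ * (ε * (√ε)⁻¹) = (√ε * √ε)⁻¹ * ε by rw [mul_inv]; ring,
          Real.mul_self_sqrt hε.le, inv_mul_cancel₀ hε.ne', one_smul])
  obtain ⟨T, hT, hTφ⟩ := exists_symm_trace (φ ∘ₗ LinearMap.inl ℝ _ _)
  choose β hβ hβφ using fun j => exists_symm_trace
    (φ ∘ₗ LinearMap.inr ℝ (Matrix m m ℝ) (Fin g → Matrix m m ℝ) ∘ₗ
      LinearMap.single ℝ (fun _ : Fin g => Matrix m m ℝ) j)
  have hφ : ∀ S Z, S.IsSymm → (∀ j, (Z j).IsSymm) →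
      φ (S, Z) = (T * S).trace + ∑ j, (β j * Z j).trace := by
    intro S Z hS hZ
    rw [← hTφ S hS]
    simp_rw [fun j => (hβφ j _ (hZ j)).symm]
    have hZs : φ (0, Z) = ∑ j, φ (0, Pi.single j (Z j)) := by
      conv_lhs => rw [← Finset.univ_sum_single Z]
      exact map_sum (φ ∘ₗ LinearMap.inr ℝ (Matrix m m ℝ) (Fin g → Matrix m m ℝ))
        (fun j => Pi.single j (Z j)) Finset.univ
    rw [← Prod.fst_add_snd (S, Z), map_add]
    simp [hZs]
  have hone : φ (1, 0) = 1 := by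
    have h1 := hφ1 ⟨_, Submodule.mem_span_singleton_self _⟩
    rw [LinearPMap.mkSpanSingleton_apply] at h1
    exact h1
  refine ⟨T, β, hT, hβ, ?_, ?_, ?_⟩
  · rw [← hone, hφ _ _ isSymm_one (by simp)]; simp
  · -- `-(1, X)` lies in the cone, with `C = 0` and `b = 2` to account for the symmetrization.
    have h1 : -((1 : Matrix m m ℝ), X) ∈ separationCone hK X := by
      refine ⟨m, inferInstance, inferInstance, 0, hK.zero_mem m, 0, 2, by norm_num, ?_, fun j => ?_⟩
      · simp only [Prod.neg_mk, transpose_neg, transpose_one, Matrix.mul_zero]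
        module
      · simp only [Prod.neg_mk, Pi.neg_apply, transpose_neg, (hX j).eq, Matrix.mul_zero]
        module
    have h2 := hφ2 _ h1
    rw [map_neg, hφ _ _ isSymm_one hX] at h2
    simp only [pform, transpose_one, Matrix.mul_one, Matrix.one_mul] at h2 ⊢
    linarith
  · intro ι _ _ Y hY C
    have hs2 := Real.mul_self_sqrt (show (0 : ℝ) ≤ 2 by norm_num)
    have hSs : (Cᵀ * C).IsSymm := by simp [IsSymm]
    have hZs : ∀ j, (Cᵀ * Y j * C).IsSymm := fun j => by
      simp [IsSymm, (hK.symm hY j).eq, Matrix.mul_assoc]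
    rw [pform, ← hφ _ _ hSs hZs]
    apply hφ2
    refine ⟨ι, inferInstance, inferInstance, Y, hY, √2 • C, 0, le_rfl, ?_, fun j => ?_⟩
    · simp only [transpose_smul, Matrix.smul_mul, Matrix.mul_smul, smul_smul, hs2, hSs.eq]
      module
    · simp only [transpose_smul, Matrix.smul_mul, Matrix.mul_smul, smul_smul, hs2, (hZs j).eq]
      module

end FreeConvex

/-! ### Values of linear pencils -/

namespace FreeConvex

open Matrix

variable {g δ : ℕ} {ι κ κ' m : Type} [Fintype ι] [DecidableEq ι] [Fintype κ] [DecidableEq κ]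
  [Fintype κ'] [DecidableEq κ'] [Fintype m] [DecidableEq m]

theorem pform_smul {ι m : Type} [Fintype ι] [Fintype m] (T : Matrix m m ℝ)
    (β : Fin g → Matrix m m ℝ) (Y : Fin g → Matrix ι ι ℝ) (C : Matrix ι m ℝ) (t : ℝ) :
    pform T β (t • Y) C = (1 - t) * (T * (Cᵀ * C)).trace + t * pform T β Y C := by
  simp only [pform, Pi.smul_apply, Matrix.mul_smul, Matrix.smul_mul, trace_smul, smul_eq_mul,
    ← Finset.mul_sum]
  ring

/-- Nonnegativity of a pencil passes from the ray below `Y` to `Y`, the form being affine in `t`. -/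
theorem pform_nonneg_of_forall_lt {ι m : Type} [Fintype ι] [Fintype m] {T : Matrix m m ℝ}
    {β : Fin g → Matrix m m ℝ} {Y : Fin g → Matrix ι ι ℝ} {C : Matrix ι m ℝ}
    (h : ∀ t : ℝ, 0 ≤ t → t < 1 → 0 ≤ pform T β (t • Y) C) : 0 ≤ pform T β Y C := by
  by_contra! hb
  have ha := h 0 le_rfl one_pos
  simp only [pform_smul, sub_zero, one_mul, zero_mul, add_zero] at ha h
  set a := (T * (Cᵀ * C)).trace
  set b := pform T β Y C
  have hab : 0 < a - b := by linarith
  -- The affine function `(1 - t)a + tb` takes the value `b / 2` at this parameter.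
  have h1 := h (1 - -b / (2 * (a - b)))
    (sub_nonneg.2 ((div_le_one (by positivity)).2 (by linarith)))
    (sub_lt_self _ (div_pos (by linarith) (by positivity)))
  have h2 : (1 - (1 - -b / (2 * (a - b)))) * a + (1 - -b / (2 * (a - b))) * b = b / 2 := by
    field_simp
    ring
  linarith

theorem pform_fromBlocks (A : Fin g → Matrix κ κ ℝ) (B : Fin g → Matrix κ' κ' ℝ)
    (Y : Fin g → Matrix ι ι ℝ) (D : Matrix ι κ ℝ) (E : Matrix ι κ' ℝ) :
    pform 1 (fun j => fromBlocks (A j) 0 0 (B j)) Y (fromCols D E) =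
      pform 1 A Y D + pform 1 B Y E := by
  have h : ∀ N : Matrix ι ι ℝ, (fromCols D E)ᵀ * N * fromCols D E =
      fromBlocks (Dᵀ * N * D) (Dᵀ * N * E) (Eᵀ * N * D) (Eᵀ * N * E) := fun N => by
    rw [transpose_fromCols, fromRows_mul, fromRows_mul_fromCols]
  have h1 := h 1
  simp only [Matrix.mul_one] at h1
  have h2 : ∀ (M : Matrix κ κ ℝ) (N : Matrix κ κ' ℝ) (P : Matrix κ' κ ℝ) (Q : Matrix κ' κ' ℝ),
      (fromBlocks M N P Q).trace = M.trace + Q.trace := fun M N P Q => by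
    simp [trace, Fintype.sum_sum_type]
  simp only [pform, h, h1, h2, fromBlocks_multiply, Matrix.one_mul, Matrix.zero_mul, add_zero,
    zero_add, Finset.sum_add_distrib]
  ring

theorem pform_one_submatrix (A : Fin g → Matrix κ κ ℝ) (Y : Fin g → Matrix ι ι ℝ) (e : κ' ≃ κ)
    (D : Matrix ι κ ℝ) :
    pform 1 (fun j => (A j).submatrix e e) Y (D.submatrix id e) = pform 1 A Y D := by
  have h : ∀ M : Matrix κ κ ℝ, (M.submatrix e e).trace = M.trace := fun M => by
    simp [trace, Equiv.sum_comp e (fun i => M i i)]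
  have h1 : ∀ N : Matrix ι ι ℝ, (D.submatrix id e)ᵀ * N * D.submatrix id e =
      (Dᵀ * N * D).submatrix e e := fun N => by
    rw [submatrix_mul _ _ _ id _ Function.bijective_id,
      submatrix_mul _ _ _ id _ Function.bijective_id]
    simp
  have h2 := h1 1
  simp only [Matrix.mul_one] at h2
  simp only [pform, Matrix.one_mul, h1, h2, submatrix_mul_equiv, h]

theorem trace_transpose_mul_self_pos {ι κ : Type} [Fintype ι] [Fintype κ] {D : Matrix ι κ ℝ}
    (hD : D ≠ 0) : 0 < (Dᵀ * D).trace := by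
  refine lt_of_le_of_ne ?_ fun h => hD ?_
  · exact Finset.sum_nonneg fun i _ => Finset.sum_nonneg fun j _ => mul_self_nonneg _
  · exact (trace_conjTranspose_mul_self_eq_zero_iff (A := D)).1 (by simpa using h.symm)

/-- The value of a pencil at a tuple `y` of scalars. -/
theorem pform_unit (T : Matrix m m ℝ) (β : Fin g → Matrix m m ℝ) (y : Fin g → ℝ) (c : m → ℝ) :
    pform T β (fun j => y j • (1 : Matrix Unit Unit ℝ)) (of fun _ => c) =
      c ⬝ᵥ (T *ᵥ c) + ∑ j, y j * (c ⬝ᵥ (β j *ᵥ c)) := by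
  have h : ∀ M : Matrix m m ℝ, (M * ((of fun _ : Unit => c)ᵀ * of fun _ : Unit => c)).trace =
      c ⬝ᵥ (M *ᵥ c) := by
    intro M
    simp only [trace, diag_apply, mul_apply, transpose_apply, of_apply, Finset.univ_unique,
      Finset.sum_singleton, dotProduct, mulVec, Finset.mul_sum]
    exact Finset.sum_congr rfl fun i _ => Finset.sum_congr rfl fun j _ => by ring
  simp [pform, Matrix.mul_smul, Matrix.smul_mul, h, trace_smul]

/-- A pencil `T ⊗ 1 + ∑ β_j ⊗ x_j` that is nonnegative on an absorbing matrix convex set is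
congruent, off the kernel of `T`, to a monic pencil. The latter is positive definite on the set
and is not at `Y` whenever the former annihilates the vector with matrix `C` at `Y` and
`CT ≠ 0`. -/
theorem exists_monic_of_nonneg
    {K : ∀ (ι : Type) [Fintype ι] [DecidableEq ι], Set (Fin g → Matrix ι ι ℝ)}
    (hK : IsMatrixConvex K) {T : Matrix m m ℝ} {β : Fin g → Matrix m m ℝ} (hT : T.IsSymm)
    (hβ : ∀ j, (β j).IsSymm)
    (hpos : ∀ (ι : Type) [Fintype ι] [DecidableEq ι], ∀ Y ∈ K ι, ∀ C : Matrix ι m ℝ,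
      0 ≤ pform T β Y C) :
    ∃ (κ : Type) (_ : Fintype κ) (_ : DecidableEq κ) (A : Fin g → Matrix κ κ ℝ),
      Fintype.card κ ≤ Fintype.card m ∧ (∀ j, (A j).IsSymm) ∧
      (∀ (ι : Type) [Fintype ι] [DecidableEq ι], ∀ Y ∈ K ι, ∀ D : Matrix ι κ ℝ, D ≠ 0 →
        0 < pform 1 A Y D) ∧
      ∀ (ι : Type) [Fintype ι] [DecidableEq ι] (Y : Fin g → Matrix ι ι ℝ) (C : Matrix ι m ℝ),
        pform T β Y C ≤ 0 → C * T ≠ 0 → ∃ D : Matrix ι κ ℝ, D ≠ 0 ∧ pform 1 A Y D ≤ 0 := by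
  have hT0 : T.PosSemidef := by
    refine .of_dotProduct_mulVec_nonneg hT fun c => ?_
    have h := hpos Unit 0 (hK.zero_mem Unit) (of fun _ => c)
    have h1 := pform_unit T β 0 c
    simp only [Pi.zero_apply, zero_smul, zero_mul, Finset.sum_const_zero, add_zero] at h1
    exact (h1 ▸ h :)
  -- `T ± εβ_j` is positive semidefinite for small `ε`, so the kernel of `T` lies in that of `β_j`.
  have hker : ∀ c, T *ᵥ c = 0 → ∀ j, β j *ᵥ c = 0 := by
    intro c hc j
    have hsmall : ∀ s : ℝ, ∃ ε > 0, ∀ c, 0 ≤ c ⬝ᵥ (T *ᵥ c) + ε * s * (c ⬝ᵥ (β j *ᵥ c)) := by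
      intro s
      obtain ⟨ε, hε, h⟩ := hK.exists_smul_mem
        (X := fun i => (Pi.single j s : Fin g → ℝ) i • (1 : Matrix Unit Unit ℝ))
        (fun i => isSymm_one.smul _)
      refine ⟨ε, hε, fun c => ?_⟩
      have h1 := hpos Unit _ h (of fun _ => c)
      have h2 := pform_unit T β (fun i => ε * (Pi.single j s : Fin g → ℝ) i) c
      simp only [mul_smul] at h2
      refine h1.trans_eq (h2.trans ?_)
      rw [Finset.sum_eq_single j] <;> simp +contextual
    obtain ⟨ε, hε, h1⟩ := hsmall 1
    obtain ⟨ε', hε', h2⟩ := hsmall (-1)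
    have h0 : c ⬝ᵥ (β j *ᵥ c) = 0 := by
      have h1 := h1 c
      have h2 := h2 c
      rw [hc, dotProduct_zero, zero_add] at h1 h2
      have h3 : 0 ≤ c ⬝ᵥ (β j *ᵥ c) := nonneg_of_mul_nonneg_right h1 (by linarith)
      have h4 : 0 ≤ ε' * -(c ⬝ᵥ (β j *ᵥ c)) := by linarith
      have h5 := nonneg_of_mul_nonneg_right h4 hε'
      linarith
    have hM : (T + ε • β j).PosSemidef := by
      refine .of_dotProduct_mulVec_nonneg ?_ fun x => ?_
      · simp [IsHermitian, hT.eq, (hβ j).eq]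
      · simpa [add_mulVec, smul_mulVec] using h1 x
    have h3 := (hM.dotProduct_mulVec_zero_iff c).1 (by simp [add_mulVec, smul_mulVec, hc, h0])
    rw [add_mulVec, hc, zero_add, smul_mulVec] at h3
    exact (smul_eq_zero.1 h3).resolve_left hε.ne'
  obtain ⟨κ, _, _, H, hH1, hH2⟩ := exists_normalizing_factor hT0
  have hform : ∀ (ι : Type) [Fintype ι] [DecidableEq ι] (Y : Fin g → Matrix ι ι ℝ)
      (D : Matrix ι κ ℝ), pform 1 (fun j => Hᵀ * β j * H) Y D = pform T β Y (D * Hᵀ) := by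
    intro ι _ _ Y D
    have h : ∀ (M : Matrix m m ℝ) (N : Matrix κ κ ℝ),
        (M * (H * N * Hᵀ)).trace = (Hᵀ * M * H * N).trace := by
      intro M N
      rw [← Matrix.mul_assoc, trace_mul_comm]
      simp only [Matrix.mul_assoc]
    simp only [pform, transpose_mul, transpose_transpose]
    rw [← hH1, ← h]
    simp_rw [← h]
    simp only [Matrix.mul_assoc]
  refine ⟨κ, inferInstance, inferInstance, fun j => Hᵀ * β j * H, ?_, fun j => ?_, ?_, ?_⟩
  · simpa using card_add_finrank_le hH1 ⊥ (by simp)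
  · simp [IsSymm, (hβ j).eq, Matrix.mul_assoc]
  · intro ι _ _ Y hY D hD
    -- The form is nonnegative even at `tY` with some `t > 1`, hence strictly positive at `Y`.
    obtain ⟨t, ht, htY⟩ := hK.exists_one_lt_smul_mem hY
    have h1 := hpos ι _ htY (D * Hᵀ)
    rw [← hform, pform_smul, Matrix.one_mul] at h1
    have h2 := trace_transpose_mul_self_pos hD
    by_contra! h3
    nlinarith
  · -- `D Hᵀ = C P`, where `Pᵀ` is a projection with kernel `ker T`, so the form does not change.
    intro ι _ _ Y C hC hCT
    refine ⟨C * T * H, fun h => hCT ?_, ?_⟩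
    · calc C * T = C * T * H * (Hᵀ * T) := by
            conv_lhs => rw [← hH2]
            simp only [Matrix.mul_assoc]
        _ = 0 := by rw [h, Matrix.zero_mul]
    · rw [hform]
      set P : Matrix m m ℝ := T * H * Hᵀ with hP
      have hPT : T * (1 - Pᵀ) = 0 := by
        rw [hP, Matrix.mul_sub, transpose_mul, transpose_mul, hT.eq, transpose_transpose,
          Matrix.mul_one, ← Matrix.mul_assoc, ← Matrix.mul_assoc, hH2, sub_self]
      have hPβ : ∀ j, β j * (1 - Pᵀ) = 0 := by
        intro j
        ext a b
        refine congrFun (hker (fun i => (1 - Pᵀ) i b) ?_ j) a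
        ext a
        exact congrFun (congrFun hPT a) b
      have habs : ∀ M : Matrix m m ℝ, M.IsSymm → M * (1 - Pᵀ) = 0 → ∀ N : Matrix ι ι ℝ,
          (M * ((C * P)ᵀ * N * (C * P))).trace = (M * (Cᵀ * N * C)).trace := by
        intro M hM hMP N
        have h1 : M * Pᵀ = M := by
          rw [Matrix.mul_sub, Matrix.mul_one, sub_eq_zero] at hMP
          exact hMP.symm
        have h2 : P * M = M := by
          have := congrArg transpose h1
          rwa [transpose_mul, transpose_transpose, hM.eq] at this
        calc (M * ((C * P)ᵀ * N * (C * P))).trace = (M * Pᵀ * (Cᵀ * N * C) * P).trace := by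
              simp only [transpose_mul, Matrix.mul_assoc]
          _ = (M * (Cᵀ * N * C)).trace := by
              rw [h1, trace_mul_comm, ← Matrix.mul_assoc, h2]
      have h1 : C * T * H * Hᵀ = C * P := by simp only [hP, Matrix.mul_assoc]
      rw [h1]
      refine le_of_eq_of_le ?_ hC
      have h2 := habs T hT hPT 1
      simp only [Matrix.mul_one] at h2
      rw [pform, pform, h2]
      simp_rw [fun j => habs (β j) (hβ j) (hPβ j) (Y j)]

/-! ### Boundary pairs and their moments -/

/-- The value at `X` of a word in the variables. -/
def wordEval (X : Fin g → Matrix ι ι ℝ) (l : List (Fin g)) : Matrix ι ι ℝ := (l.map X).prod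

theorem wordEval_append (X : Fin g → Matrix ι ι ℝ) (l l' : List (Fin g)) :
    wordEval X (l ++ l') = wordEval X l * wordEval X l' := by
  simp [wordEval]

theorem wordEval_reverse {X : Fin g → Matrix ι ι ℝ} (hX : ∀ j, (X j).IsSymm) (l : List (Fin g)) :
    wordEval X l.reverse = (wordEval X l)ᵀ := by
  induction l with
  | nil => simp [wordEval]
  | cons x l ih =>
    rw [List.reverse_cons, wordEval_append, ih]
    simp [wordEval, (hX x).eq]

theorem wordEval_fromBlocks (X : Fin g → Matrix ι ι ℝ) (Y : Fin g → Matrix κ κ ℝ)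
    (l : List (Fin g)) :
    wordEval (fun j => fromBlocks (X j) 0 0 (Y j)) l =
      fromBlocks (wordEval X l) 0 0 (wordEval Y l) := by
  induction l with
  | nil => simp [wordEval]
  | cons x l ih =>
    simp only [wordEval, List.map_cons, List.prod_cons] at ih ⊢
    rw [ih, fromBlocks_multiply]
    simp

theorem lift_eq_sum_wordEval (X : Fin g → Matrix ι ι ℝ) (a : NCPoly g) :
    FreeAlgebra.lift ℝ X a = ∑ w ∈ ((FreeAlgebra.basisFreeMonoid ℝ (Fin g)).repr a).support,
      (FreeAlgebra.basisFreeMonoid ℝ (Fin g)).repr a w • wordEval X w.toList := by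
  have hb : ∀ w, FreeAlgebra.lift ℝ X (FreeAlgebra.basisFreeMonoid ℝ (Fin g) w) =
      wordEval X w.toList := by
    intro w
    simp [FreeAlgebra.basisFreeMonoid, FreeAlgebra.equivMonoidAlgebraFreeMonoid, wordEval,
      FreeMonoid.lift_apply, map_list_prod, Function.comp_def]
  conv_lhs => rw [← (FreeAlgebra.basisFreeMonoid ℝ (Fin g)).linearCombination_repr a]
  rw [Finsupp.linearCombination_apply, Finsupp.sum, map_sum]
  simp [hb]

/-- Pairs of a row index `i < δ` and a word of length at most `k`. -/
abbrev RowWord (g δ k : ℕ) : Type := Fin δ × Σ j : Fin (k + 1), (Fin j → Fin g)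

theorem card_rowWord (g δ k : ℕ) : Fintype.card (RowWord g δ k) = wordCount g δ k := by
  simp [wordCount, Finset.sum_range]

/-- The matrix with columns `w(X) v_i`, for `i < δ` and words `w` of length at most `k`. It maps
a row `q` of `δ` polynomials of degree at most `k`, given by coefficients, to `q(X) v`. -/
def krylov (k : ℕ) (X : Fin g → Matrix ι ι ℝ) (v : Fin δ → ι → ℝ) :
    Matrix ι (RowWord g δ k) ℝ :=
  of fun a z => (wordEval X (List.ofFn z.2.2) *ᵥ v z.1) a

theorem krylov_fromBlocks (k : ℕ) (X : Fin g → Matrix ι ι ℝ) (Y : Fin g → Matrix κ κ ℝ)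
    (v : Fin δ → ι → ℝ) (w : Fin δ → κ → ℝ) :
    krylov k (fun j => fromBlocks (X j) 0 0 (Y j)) (fun i => Sum.elim (v i) (w i)) =
      fromRows (krylov k X v) (krylov k Y w) := by
  ext a z
  rcases a with a | a <;>
    simp [krylov, wordEval_fromBlocks, fromBlocks_mulVec]

/-- If `N` fixes the columns of the Krylov matrix it fixes all `w(X) v_i` with `|w| ≤ k`. -/
theorem mulVec_wordEval_of_mul_krylov {k : ℕ} {X : Fin g → Matrix ι ι ℝ} {v : Fin δ → ι → ℝ}
    {N : Matrix ι ι ℝ} (h : N * krylov k X v = krylov k X v)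
    {l : List (Fin g)} (hl : l.length ≤ k) (i : Fin δ) :
    N *ᵥ (wordEval X l *ᵥ v i) = wordEval X l *ᵥ v i := by
  ext a
  have h1 := congrFun (congrFun h a) (i, ⟨⟨l.length, by omega⟩, l.get⟩)
  simp only [mul_apply, krylov, of_apply, List.ofFn_get] at h1
  exact h1

/-- Compression to the column space of the Krylov matrix does not change `w(X) v_i` for
`|w| ≤ k`. -/
theorem wordEval_compress {k : ℕ} {X : Fin g → Matrix ι ι ℝ} {v : Fin δ → ι → ℝ}
    {V : Matrix ι m ℝ} (h : V * Vᵀ * krylov k X v = krylov k X v) (i : Fin δ)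
    {l : List (Fin g)} (hl : l.length ≤ k) :
    V *ᵥ (wordEval (fun j => Vᵀ * X j * V) l *ᵥ (Vᵀ *ᵥ v i)) = wordEval X l *ᵥ v i := by
  induction l with
  | nil => simpa [wordEval] using mulVec_wordEval_of_mul_krylov h (l := []) (by simp) i
  | cons x l ih =>
    have hl' : l.length ≤ k := by simp at hl; omega
    have hc : ∀ {n : Type} [Fintype n] [DecidableEq n] (Y : Fin g → Matrix n n ℝ),
        wordEval Y (x :: l) = Y x * wordEval Y l := fun Y => by simp [wordEval]
    rw [← mulVec_wordEval_of_mul_krylov h hl i, hc, hc, ← mulVec_mulVec,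
      ← mulVec_mulVec (M := X x), ← ih hl']
    simp only [mulVec_mulVec, Matrix.mul_assoc]

theorem dotProduct_wordEval_compress {k : ℕ} {X : Fin g → Matrix ι ι ℝ}
    (hX : ∀ j, (X j).IsSymm) {v : Fin δ → ι → ℝ} {V : Matrix ι m ℝ} (hV : Vᵀ * V = 1)
    (h : V * Vᵀ * krylov k X v = krylov k X v) (i j : Fin δ) {l : List (Fin g)}
    (hl : l.length ≤ 2 * k) :
    (Vᵀ *ᵥ v i) ⬝ᵥ (wordEval (fun j => Vᵀ * X j * V) l *ᵥ (Vᵀ *ᵥ v j)) =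
      v i ⬝ᵥ (wordEval X l *ᵥ v j) := by
  have hX' : ∀ j, (Vᵀ * X j * V).IsSymm := fun j => by
    simp [IsSymm, (hX j).eq, Matrix.mul_assoc]
  have hsplit : ∀ {n : Type} [Fintype n] [DecidableEq n] {Y : Fin g → Matrix n n ℝ}
      (_ : ∀ j, (Y j).IsSymm) (x y : n → ℝ), x ⬝ᵥ (wordEval Y l *ᵥ y) =
        (wordEval Y (l.take k).reverse *ᵥ x) ⬝ᵥ (wordEval Y (l.drop k) *ᵥ y) := by
    intro n _ _ Y hY x y
    conv_lhs => rw [← List.take_append_drop k l]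
    rw [wordEval_append, ← mulVec_mulVec, wordEval_reverse hY, dotProduct_mulVec, mulVec_transpose]
  rw [hsplit hX, hsplit hX', ← wordEval_compress h i (l := (l.take k).reverse) (by simp),
    ← wordEval_compress h j (l := l.drop k) (by simp; omega)]
  rw [dotProduct_mulVec (V *ᵥ _), vecMul_mulVec, hV, vecMul_one]

/-- Compression to the column space of the Krylov matrix preserves `⟨p(X) v, v⟩`: a word of length
at most `2k` is a product of two words of length at most `k`. -/
theorem quad_compress {p : MatPoly g δ} {k : ℕ} (hp : MatPoly.degree p ≤ 2 * k)
    {X : Fin g → Matrix ι ι ℝ} (hX : ∀ j, (X j).IsSymm) {v : Fin δ → ι → ℝ} {V : Matrix ι m ℝ}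
    (hV : Vᵀ * V = 1) (h : V * Vᵀ * krylov k X v = krylov k X v) :
    quad p (fun j => Vᵀ * X j * V) (fun i => Vᵀ *ᵥ v i) = quad p X v := by
  simp only [quad]
  refine Finset.sum_congr rfl fun i _ => Finset.sum_congr rfl fun j _ => ?_
  simp only [lift_eq_sum_wordEval, sum_mulVec, dotProduct_sum, smul_mulVec, dotProduct_smul]
  refine Finset.sum_congr rfl fun w hw => ?_
  rw [dotProduct_wordEval_compress hX hV h]
  have h1 : FreeMonoid.length w ≤ FreeConvex.degree (p i j) := Finset.le_sup hw
  have h2 : FreeConvex.degree (p i j) ≤ MatPoly.degree p :=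
    (Finset.le_sup (f := fun j => FreeConvex.degree (p i j)) (Finset.mem_univ j)).trans
      (Finset.le_sup (f := fun i => Finset.univ.sup fun j => FreeConvex.degree (p i j))
        (Finset.mem_univ i))
  exact h1.trans (h2.trans hp)

/-- `X` is a boundary point of the positivity set, seen from `0`, and `v` is a nonzero vector on
which `p(X)` is not positive. -/
def IsBoundaryPair (p : MatPoly g δ) (X : Fin g → Matrix ι ι ℝ) (v : Fin δ → ι → ℝ) : Prop :=
  (∀ j, (X j).IsSymm) ∧ v ≠ 0 ∧ quad p X v ≤ 0 ∧
    ∀ t : ℝ, 0 ≤ t → t < 1 → t • X ∈ raySet p ι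

/-- The moments of degree at most `2k + 1` of boundary pairs `(X, v)` such that `q(X) v = 0` for all
`q` in `U`. They are collected in the Gram matrix `ΞᵀΞ` of the Krylov matrix and the `ΞᵀX_jΞ`. -/
def momentSet (p : MatPoly g δ) (k : ℕ) (U : Submodule ℝ (RowWord g δ k → ℝ)) :
    Set (Matrix (RowWord g δ k) (RowWord g δ k) ℝ ×
      (Fin g → Matrix (RowWord g δ k) (RowWord g δ k) ℝ)) :=
  {P | ∃ (ι : Type) (_ : Fintype ι) (_ : DecidableEq ι) (X : Fin g → Matrix ι ι ℝ)
    (v : Fin δ → ι → ℝ), IsBoundaryPair p X v ∧ (∀ u ∈ U, krylov k X v *ᵥ u = 0) ∧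
      P = ((krylov k X v)ᵀ * krylov k X v, fun j => (krylov k X v)ᵀ * X j * krylov k X v)}

/-- The moments of a direct sum of boundary pairs are the sums of their moments. -/
theorem add_mem_momentSet {p : MatPoly g δ} (hK : IsMatrixConvex (fun ι => raySet p ι)) {k : ℕ}
    {U : Submodule ℝ (RowWord g δ k → ℝ)} :
    ∀ a ∈ momentSet p k U, ∀ b ∈ momentSet p k U, a + b ∈ momentSet p k U := by
  rintro _ ⟨ι, _, _, X, v, ⟨hX1, hX2, hX3, hX4⟩, hXU, rfl⟩ _
    ⟨κ, _, _, Y, w, ⟨hY1, hY2, hY3, hY4⟩, hYU, rfl⟩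
  refine ⟨ι ⊕ κ, inferInstance, inferInstance, fun j => fromBlocks (X j) 0 0 (Y j),
    fun i => Sum.elim (v i) (w i), ⟨fun j => (hX1 j).fromBlocks (by simp) (hY1 j), fun h => hX2 ?_,
      ?_, fun t h0 h1 => ?_⟩, fun u hu => ?_, ?_⟩
  · ext i a
    exact congrFun (congrFun h i) (Sum.inl a)
  · rw [quad_fromBlocks]
    exact add_nonpos hX3 hY3
  · convert hK.directSum_mem (hX4 t h0 h1) (hY4 t h0 h1) using 2 with j
    simp [fromBlocks_smul]
  · rw [krylov_fromBlocks, fromRows_mulVec, hXU u hu, hYU u hu]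
    ext a; rcases a with a | a <;> rfl
  · simp only [krylov_fromBlocks, transpose_fromRows, fromCols_mul_fromRows,
      fromCols_mul_fromBlocks, Matrix.mul_zero, add_zero, zero_add]
    rfl

/-- The value of a pencil on the vector with matrix `ΞG`, `Ξ` a Krylov matrix, as a functional of
the moments. -/
def momentFunctional {k : ℕ} (T : Matrix m m ℝ) (β : Fin g → Matrix m m ℝ)
    (G : Matrix (RowWord g δ k) m ℝ) :
    (Matrix (RowWord g δ k) (RowWord g δ k) ℝ ×
      (Fin g → Matrix (RowWord g δ k) (RowWord g δ k) ℝ)) →ₗ[ℝ] ℝ where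
  toFun P := (T * (Gᵀ * P.1 * G)).trace + ∑ j, (β j * (Gᵀ * P.2 j * G)).trace
  map_add' P Q := by
    simp only [Prod.fst_add, Prod.snd_add, Pi.add_apply, Matrix.mul_add, Matrix.add_mul, trace_add,
      Finset.sum_add_distrib]
    ring
  map_smul' c P := by
    simp only [Prod.smul_fst, Prod.smul_snd, Pi.smul_apply, Matrix.mul_smul, Matrix.smul_mul,
      trace_smul, ← Finset.smul_sum, smul_add, RingHom.id_apply]

theorem momentFunctional_krylov {m : Type} [Fintype m] {k : ℕ} (T : Matrix m m ℝ)
    (β : Fin g → Matrix m m ℝ) (G : Matrix (RowWord g δ k) m ℝ) (X : Fin g → Matrix ι ι ℝ)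
    (v : Fin δ → ι → ℝ) :
    momentFunctional T β G
      ((krylov k X v)ᵀ * krylov k X v, fun j => (krylov k X v)ᵀ * X j * krylov k X v) =
      pform T β X (krylov k X v * G) := by
  simp only [momentFunctional, LinearMap.coe_mk, AddHom.coe_mk, pform, transpose_mul,
    Matrix.mul_assoc]

/-! ### Construction of the pencil -/

/-- A monic pencil, positive definite on the positivity set, that fails to be so at all boundary
pairs annihilated by `U`, except for those annihilated by a strictly larger space `U'`. -/
theorem exists_pencil_step {p : MatPoly g δ} (hK : IsMatrixConvex (fun ι => raySet p ι)) {k : ℕ}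
    (hp : MatPoly.degree p ≤ 2 * k) (U : Submodule ℝ (RowWord g δ k → ℝ))
    (hne : (momentSet p k U).Nonempty) :
    ∃ (κ : Type) (_ : Fintype κ) (_ : DecidableEq κ) (A : Fin g → Matrix κ κ ℝ)
      (U' : Submodule ℝ (RowWord g δ k → ℝ)), U < U' ∧
      Fintype.card κ + Module.finrank ℝ U ≤ Fintype.card (RowWord g δ k) ∧
      (∀ j, (A j).IsSymm) ∧
      (∀ (ι : Type) [Fintype ι] [DecidableEq ι], ∀ Y ∈ raySet p ι, ∀ D : Matrix ι κ ℝ, D ≠ 0 →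
        0 < pform 1 A Y D) ∧
      ∀ (ι : Type) [Fintype ι] [DecidableEq ι] (Y : Fin g → Matrix ι ι ℝ) (w : Fin δ → ι → ℝ),
        IsBoundaryPair p Y w → (∀ u ∈ U, krylov k Y w *ᵥ u = 0) →
        (∀ u ∈ U', krylov k Y w *ᵥ u = 0) ∨ ∃ D : Matrix ι κ ℝ, D ≠ 0 ∧ pform 1 A Y D ≤ 0 := by
  obtain ⟨_, ⟨ι, _, _, X, v, hXv, hXU, rfl⟩, hdom⟩ :=
    exists_dominating hne (add_mem_momentSet hK)
  set Ξ := krylov k X v with hΞ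
  have hpsd : (Ξᵀ * Ξ).PosSemidef := by
    simpa using posSemidef_conjTranspose_mul_self Ξ
  obtain ⟨m, _, _, G, hG1, hG2⟩ := exists_normalizing_factor hpsd
  -- `V = ΞG` is an isometry onto the column space of `Ξ`.
  have hV : (Ξ * G)ᵀ * (Ξ * G) = 1 := by
    rw [← hG1, transpose_mul]
    simp only [Matrix.mul_assoc]
  have hfix : (Ξ * G) * (Ξ * G)ᵀ * Ξ = Ξ := by
    rw [← sub_eq_zero]
    refine (trace_conjTranspose_mul_self_eq_zero_iff).1 ?_
    have h1 : ((Ξ * G) * (Ξ * G)ᵀ * Ξ - Ξ)ᵀ * ((Ξ * G) * (Ξ * G)ᵀ * Ξ - Ξ) = 0 := by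
      set Q := (Ξ * G) * (Ξ * G)ᵀ with hQ
      have hQQ : Q * Q = Q := by
        rw [hQ, Matrix.mul_assoc, ← Matrix.mul_assoc _ (Ξ * G), hV, Matrix.one_mul]
      have hQt : Qᵀ = Q := by simp [hQ]
      have h2 : Ξᵀ * (Q * Ξ) = Ξᵀ * Ξ := by
        conv_rhs => rw [← hG2]
        simp only [hQ, transpose_mul, Matrix.mul_assoc]
      have h3 : Ξᵀ * Q * (Q * Ξ) = Ξᵀ * Ξ := by
        rw [Matrix.mul_assoc, ← Matrix.mul_assoc Q, hQQ, h2]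
      rw [transpose_sub, transpose_mul, hQt, Matrix.sub_mul, Matrix.mul_sub, Matrix.mul_sub, h3, h2,
        Matrix.mul_assoc, h2]
      simp
    rw [conjTranspose_eq_transpose_of_trivial, h1, trace_zero]
  set V := Ξ * G with hVdef
  have hvV : ∀ i, V *ᵥ (Vᵀ *ᵥ v i) = v i := fun i => by
    simpa [wordEval] using wordEval_compress hfix i (l := []) (by simp)
  have hX'K : (fun j => Vᵀ * X j * V) ∉ raySet p m := by
    intro h
    have h1 := h.2 1 (by simp) (fun i => Vᵀ *ᵥ v i) fun h0 => hXv.2.1 (funext fun i => by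
      rw [← hvV i, show Vᵀ *ᵥ v i = 0 from congrFun h0 i, mulVec_zero]; rfl)
    rw [one_smul, quad_compress hp hXv.1 hV hfix] at h1
    exact h1.not_ge hXv.2.2.1
  obtain ⟨T, β, hT, hβ, htr, hX'0, hpos⟩ := exists_separating_pencil hK
    (X := fun j => Vᵀ * X j * V) (fun j => by simp [IsSymm, (hXv.1 j).eq, Matrix.mul_assoc]) hX'K
  -- The form at `ΞG` vanishes for `(X, v)`, hence for all boundary pairs annihilated by `U`.
  have hnn : ∀ b ∈ momentSet p k U, 0 ≤ momentFunctional T β G b := by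
    rintro _ ⟨ι', _, _, Y, w, hYw, -, rfl⟩
    rw [momentFunctional_krylov]
    exact pform_nonneg_of_forall_lt fun t h0 h1 => hpos _ _ (hYw.2.2.2 t h0 h1) _
  have hzero := hdom (momentFunctional T β G) hnn <| by
    refine le_antisymm ?_ (hnn _ ⟨ι, _, _, X, v, hXv, hXU, rfl⟩)
    rw [momentFunctional_krylov]
    refine le_of_eq_of_le ?_ hX'0
    simp [pform, ← hΞ, ← hVdef, hV]
  obtain ⟨κ, _, _, A, hcard, hA, hApos, hAbd⟩ := exists_monic_of_nonneg hK hT hβ hpos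
  refine ⟨κ, inferInstance, inferInstance, A, U ⊔ LinearMap.range (G * T).mulVecLin, ?_, ?_, hA,
    hApos, ?_⟩
  · refine lt_of_le_of_ne le_sup_left fun h => ?_
    have h1 : V * T = 0 := by
      ext a b
      have h2 : (G * T) *ᵥ Pi.single b 1 ∈ U := by
        rw [h]
        exact le_sup_right (a := U) ⟨Pi.single b 1, rfl⟩
      have h3 := congrFun (hXU _ h2) a
      rw [mulVec_mulVec, ← Matrix.mul_assoc] at h3
      simpa using h3
    have h2 : T = 0 := by
      rw [← Matrix.one_mul T, ← hV, Matrix.mul_assoc, h1, Matrix.mul_zero]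
    simp [h2] at htr
  · have h1 := card_add_finrank_le hG1 U fun u hu => by
      rw [← mulVec_mulVec, hXU u hu, mulVec_zero]
    omega
  · intro ι' _ _ Y w hYw hYU
    by_cases hYT : krylov k Y w * G * T = 0
    · left
      intro u hu
      obtain ⟨u1, hu1, _, ⟨c, rfl⟩, rfl⟩ := Submodule.mem_sup.1 hu
      rw [mulVec_add, hYU u1 hu1, mulVecLin_apply, mulVec_mulVec, ← Matrix.mul_assoc, hYT]
      simp
    · right
      refine hAbd ι' Y (krylov k Y w * G) ?_ hYT
      rw [← momentFunctional_krylov]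
      exact (hzero _ ⟨ι', _, _, Y, w, hYw, hYU, rfl⟩).le

/-- The direct sum of the pencils obtained by iterating `exists_pencil_step` works for all boundary
pairs annihilated by `U`. As the codimension `r` of `U` bounds the size of the first summand and
drops at each step, the total size is at most `r + (r - 1) + ⋯ + 1`. -/
theorem exists_pencil_of_codim {p : MatPoly g δ} (hK : IsMatrixConvex (fun ι => raySet p ι))
    {k : ℕ} (hp : MatPoly.degree p ≤ 2 * k) (r : ℕ) (U : Submodule ℝ (RowWord g δ k → ℝ))
    (hr : Fintype.card (RowWord g δ k) ≤ r + Module.finrank ℝ U) :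
    ∃ (κ : Type) (_ : Fintype κ) (_ : DecidableEq κ) (A : Fin g → Matrix κ κ ℝ),
      Fintype.card κ ≤ ∑ i ∈ Finset.range (r + 1), i ∧ (∀ j, (A j).IsSymm) ∧
      (∀ (ι : Type) [Fintype ι] [DecidableEq ι], ∀ Y ∈ raySet p ι, ∀ D : Matrix ι κ ℝ, D ≠ 0 →
        0 < pform 1 A Y D) ∧
      ∀ (ι : Type) [Fintype ι] [DecidableEq ι] (Y : Fin g → Matrix ι ι ℝ) (w : Fin δ → ι → ℝ),
        IsBoundaryPair p Y w → (∀ u ∈ U, krylov k Y w *ᵥ u = 0) →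
        ∃ D : Matrix ι κ ℝ, D ≠ 0 ∧ pform 1 A Y D ≤ 0 := by
  induction r generalizing U with
  | zero =>
    rcases (momentSet p k U).eq_empty_or_nonempty with hU | hU
    · refine ⟨Empty, inferInstance, inferInstance, fun _ => 0, by simp, by simp,
        fun ι _ _ Y _ D hD => (hD (Subsingleton.elim _ _)).elim, fun ι _ _ Y w hY hYU => ?_⟩
      exact (Set.eq_empty_iff_forall_notMem.1 hU _ ⟨ι, _, _, Y, w, hY, hYU, rfl⟩).elim
    · obtain ⟨κ, _, _, A, U', hlt, -⟩ := exists_pencil_step hK hp U hU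
      have h1 := Submodule.finrank_lt_finrank_of_lt hlt
      have h2 := Submodule.finrank_le U'
      rw [Module.finrank_fintype_fun_eq_card] at h2
      omega
  | succ r ih =>
    rcases (momentSet p k U).eq_empty_or_nonempty with hU | hU
    · refine ⟨Empty, inferInstance, inferInstance, fun _ => 0, by simp, by simp,
        fun ι _ _ Y _ D hD => (hD (Subsingleton.elim _ _)).elim, fun ι _ _ Y w hY hYU => ?_⟩
      exact (Set.eq_empty_iff_forall_notMem.1 hU _ ⟨ι, _, _, Y, w, hY, hYU, rfl⟩).elim
    · obtain ⟨κ, _, _, A, U', hlt, hcard, hA, hApos, hAbd⟩ := exists_pencil_step hK hp U hU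
      have h1 := Submodule.finrank_lt_finrank_of_lt hlt
      obtain ⟨κ', _, _, B, hcard', hB, hBpos, hBbd⟩ := ih U' (by omega)
      refine ⟨κ ⊕ κ', inferInstance, inferInstance, fun j => fromBlocks (A j) 0 0 (B j), ?_,
        fun j => (hA j).fromBlocks (by simp) (hB j), fun ι _ _ Y hY D hD => ?_,
        fun ι _ _ Y w hYw hYU => ?_⟩
      · rw [Fintype.card_sum, Finset.sum_range_succ]
        omega
      · rw [← fromCols_toCols D, pform_fromBlocks]
        have hA0 : 0 ≤ pform 1 A Y D.toCols₁ := by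
          by_cases h : D.toCols₁ = 0
          · simp [h, pform]
          · exact (hApos ι Y hY _ h).le
        have hB0 : 0 ≤ pform 1 B Y D.toCols₂ := by
          by_cases h : D.toCols₂ = 0
          · simp [h, pform]
          · exact (hBpos ι Y hY _ h).le
        by_cases h : D.toCols₁ = 0
        · refine add_pos_of_nonneg_of_pos hA0 (hBpos ι Y hY _ fun h' => hD ?_)
          rw [← fromCols_toCols D, h, h', fromCols_zero]
        · exact add_pos_of_pos_of_nonneg (hApos ι Y hY _ h) hB0
      · rcases hAbd ι Y w hYw hYU with h | ⟨D, hD, hle⟩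
        · obtain ⟨D, hD, hle⟩ := hBbd ι Y w hYw h
          refine ⟨fromCols 0 D, fun h => hD ?_, ?_⟩
          · rw [← toCols₂_fromCols (0 : Matrix ι κ ℝ) D, h]; rfl
          · rw [pform_fromBlocks]
            simpa [pform] using hle
        · refine ⟨fromCols D 0, fun h => hD ?_, ?_⟩
          · rw [← toCols₁_fromCols D (0 : Matrix ι κ' ℝ), h]; rfl
          · rw [pform_fromBlocks]
            simpa [pform] using hle

/-- On the ray through a symmetric tuple outside the positivity set, the first parameter at which
positivity of `p` fails gives a boundary pair. -/
theorem exists_boundaryPair {p : MatPoly g δ} (h0 : p.atZero.PosDef) {X : Fin g → Matrix ι ι ℝ}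
    (hX : ∀ j, (X j).IsSymm) (hXK : X ∉ raySet p ι) :
    ∃ t : ℝ, 0 < t ∧ t ≤ 1 ∧ ∃ v, IsBoundaryPair p (t • X) v := by
  have hcpt : IsCompact (Set.Icc (0 : ℝ) 1 ∩ {t : ℝ | Pos p (t • X)}ᶜ) :=
    isCompact_Icc.inter_right (isOpen_pos_smul p X).isClosed_compl
  have hne : (Set.Icc (0 : ℝ) 1 ∩ {t : ℝ | Pos p (t • X)}ᶜ).Nonempty := by
    by_contra h
    refine hXK ⟨hX, fun t ht => ?_⟩
    by_contra ht'
    exact h ⟨t, ht, ht'⟩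
  obtain ⟨t, ⟨⟨ht0, ht1⟩, htX⟩, hmin⟩ := hcpt.exists_isLeast hne
  have htpos : 0 < t := by
    refine lt_of_le_of_ne ht0 fun h => htX ?_
    change Pos p _
    rw [← h, zero_smul]
    exact pos_zero h0
  have htX' : ¬ Pos p (t • X) := htX
  simp only [Pos, not_forall, not_lt] at htX'
  obtain ⟨v, hv, hq⟩ := htX'
  refine ⟨t, htpos, ht1, v, fun j => (hX j).smul t, hv, hq, fun s hs0 hs1 =>
    ⟨fun j => ((hX j).smul t).smul s, fun u hu => ?_⟩⟩
  rw [smul_smul, smul_smul, mul_assoc]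
  by_contra h
  have hlt : u * (s * t) < t := by nlinarith [hu.1, hu.2, mul_nonneg hs0 ht0]
  have := hmin ⟨⟨mul_nonneg hu.1 (mul_nonneg hs0 ht0), hlt.le.trans ht1⟩, h⟩
  linarith

theorem MonicPencil.eval_posDef_iff {μ n : ℕ} (L : MonicPencil g μ) {X : Tuple g n}
    (hX : ∀ j, (X j).IsSymm) :
    (L.eval X).PosDef ↔ ∀ D : Matrix (Fin n) (Fin μ) ℝ, D ≠ 0 → 0 < pform 1 L.coeff X D := by
  have hform : ∀ D : Matrix (Fin n) (Fin μ) ℝ,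
      vec D ⬝ᵥ (L.eval X *ᵥ vec D) = pform 1 L.coeff X D := by
    intro D
    simp only [MonicPencil.eval, add_mulVec, sum_mulVec, dotProduct_add, dotProduct_sum,
      kronecker_mulVec_vec, vec_dotProduct_vec, pform, Matrix.one_mul, transpose_one,
      Matrix.mul_one]
    congr 1
    refine Finset.sum_congr rfl fun j _ => ?_
    rw [(L.isSymm j).eq, ← Matrix.mul_assoc, trace_mul_comm, Matrix.mul_assoc]
  rw [posDef_iff_dotProduct_mulVec]
  constructor
  · rintro ⟨-, h⟩ D hD
    rw [← hform]
    exact h fun h0 => hD (vec_eq_zero_iff.1 h0)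
  · refine fun h => ⟨?_, fun x hx => ?_⟩
    · simp only [IsHermitian, MonicPencil.eval, conjTranspose_eq_transpose_of_trivial,
        transpose_add, transpose_sum, ← kroneckerMap_transpose, (hX _).eq, (L.isSymm _).eq,
        transpose_one]
    · have hvec : vec (of fun a c => x (c, a)) = x := rfl
      have := h (of fun a c => x (c, a)) fun h0 => hx (by rw [← hvec, h0]; rfl)
      rw [← hform, hvec] at this
      simpa using this

/-- A convex connected component containing `0` consists of the points whose segment to `0` stays in
the set. -/
theorem mem_positivitySet_iff {p : MatPoly g δ} (hp : p.IsHermitian) (h0 : p.atZero.PosDef)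
    {n : ℕ} (hc : Convex ℝ (p.positivitySet n)) {X : Tuple g n} :
    X ∈ p.positivitySet n ↔ X ∈ raySet p (Fin n) := by
  have hzero : (0 : Tuple g n) ∈ p.posDefSet n :=
    ⟨fun j => by simp, (eval_posDef_iff hp fun j => by simp).2 (pos_zero h0)⟩
  constructor
  · intro h
    refine ⟨(connectedComponentIn_subset _ _ h).1, fun t ht => ?_⟩
    have h1 := connectedComponentIn_subset _ _
      (hc.smul_mem_of_zero_mem (mem_connectedComponentIn hzero) h ht)
    exact (eval_posDef_iff hp h1.1).1 h1.2
  · rintro ⟨hX, h⟩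
    have h1 : segment ℝ 0 X ⊆ p.posDefSet n := by
      rw [segment_eq_image]
      rintro _ ⟨t, ht, rfl⟩
      have hs : ∀ j, ((t • X) j).IsSymm := fun j => (hX j).smul t
      simp only [smul_zero, zero_add]
      exact ⟨hs, (eval_posDef_iff hp hs).2 (h t ht)⟩
    exact (convex_segment 0 X).isPreconnected.subset_connectedComponentIn (left_mem_segment ℝ 0 X)
      h1 (right_mem_segment ℝ 0 X)

/-- A convex positivity set of degree at most `2k` is the solution set of a monic pencil of size at
most `N(N + 1)/2`, where `N = δ ∑_{j ≤ k} g^j` is the number of pairs of a row index and a word of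
length at most `k`. -/
theorem exists_pencil_of_degree_le {p : MatPoly g δ} (hp : p.IsHermitian) (h0 : p.atZero.PosDef)
    (hconv : GradedConvex p.positivitySet) {k : ℕ} (hk : MatPoly.degree p ≤ 2 * k) :
    ∃ μ : ℕ, μ ≤ wordCount g δ k * (wordCount g δ k + 1) / 2 ∧
      ∃ L : MonicPencil g μ, ∀ n : ℕ, 0 < n → p.positivitySet n = L.solutionSet n := by
  have hc : ∀ n, Convex ℝ (raySet p (Fin n)) := by
    intro n
    rcases n.eq_zero_or_pos with rfl | hn
    · exact Set.Subsingleton.convex fun X _ Y _ => Subsingleton.elim X Y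
    · rw [← show p.positivitySet n = raySet p (Fin n) from
        Set.ext fun X => mem_positivitySet_iff hp h0 (hconv n hn)]
      exact hconv n hn
  have hK := isMatrixConvex_raySet h0 hc
  obtain ⟨κ, _, _, A, hcard, hA, hApos, hAbd⟩ :=
    exists_pencil_of_codim hK hk (Fintype.card (RowWord g δ k)) ⊥ (by omega)
  let e := (Fintype.equivFin κ).symm
  let L : MonicPencil g (Fintype.card κ) :=
    ⟨fun j => (A j).submatrix e e, fun j => (hA j).submatrix e⟩
  refine ⟨Fintype.card κ, ?_, L, fun n hn => ?_⟩
  · rwa [Finset.sum_range_id, card_rowWord, Nat.add_sub_cancel, mul_comm] at hcard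
  have hL : ∀ {X : Tuple g n}, (∀ j, (X j).IsSymm) → ((L.eval X).PosDef ↔
      ∀ D : Matrix (Fin n) κ ℝ, D ≠ 0 → 0 < pform 1 A X D) := by
    intro X hX
    rw [L.eval_posDef_iff hX]
    refine ⟨fun h D hD => ?_, fun h D hD => ?_⟩
    · rw [← pform_one_submatrix A X e D]
      refine h _ fun h' => hD ?_
      simpa using congrArg (·.submatrix id e.symm) h'
    · have h1 := h (D.submatrix id e.symm) fun h' => hD (by
        simpa using congrArg (·.submatrix id e) h')
      rw [← pform_one_submatrix A X e] at h1
      simpa using h1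
  ext X
  rw [mem_positivitySet_iff hp h0 (hconv n hn)]
  refine ⟨fun h => ⟨h.1, (hL h.1).2 fun D hD => hApos _ X h D hD⟩, fun ⟨hX, h⟩ => ?_⟩
  by_contra hXK
  obtain ⟨t, ht0, ht1, v, hb⟩ := exists_boundaryPair h0 hX hXK
  obtain ⟨D, hD, hle⟩ := hAbd _ _ v hb (by simp)
  have h1 := (hL hX).1 h D hD
  have h2 := trace_transpose_mul_self_pos hD
  rw [pform_smul, Matrix.one_mul] at hle
  nlinarith [mul_nonneg (sub_nonneg.2 ht1) h2.le, mul_pos ht0 h1]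

end FreeConvex

theorem mainTheorem2 (g δ d : ℕ) (p : FreeConvex.MatPoly g δ)
    (hsymm : p.IsHermitian)
    (hdeg : FreeConvex.MatPoly.degree p = d)
    (hzero : (FreeConvex.MatPoly.atZero p).PosDef)
    (hbdd : FreeConvex.GradedBounded (FreeConvex.MatPoly.positivitySet p))
    (hconv : FreeConvex.GradedConvex (FreeConvex.MatPoly.positivitySet p)) :
    (∃ μ : ℕ, μ ≤ FreeConvex.wordCount g δ d * (FreeConvex.wordCount g δ d + 1) / 2 ∧
      ∃ L : FreeConvex.MonicPencil g μ, ∀ n : ℕ, 0 < n →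
        FreeConvex.MatPoly.positivitySet p n = L.solutionSet n) ∧
    (FreeConvex.MatPoly.atZero p = 1 →
      ∃ μ : ℕ, μ ≤ FreeConvex.wordCount g δ ⌈(d : ℚ) / 2⌉₊ *
          (FreeConvex.wordCount g δ ⌈(d : ℚ) / 2⌉₊ + 1) / 2 ∧
        ∃ L : FreeConvex.MonicPencil g μ, ∀ n : ℕ, 0 < n →
          FreeConvex.MatPoly.positivitySet p n = L.solutionSet n) := by
  refine ⟨FreeConvex.exists_pencil_of_degree_le hsymm hzero hconv (by omega), fun _ =>
    FreeConvex.exists_pencil_of_degree_le hsymm hzero hconv ?_⟩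
  have h1 := Nat.le_ceil ((d : ℚ) / 2)
  have h2 : (d : ℚ) ≤ 2 * (⌈(d : ℚ) / 2⌉₊ : ℚ) := by linarith
  rw [hdeg]
  exact_mod_cast h2
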